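/- **Setting.** Fix a language of propositional logic: its sentences are built with $\lnot,\land,\lor,\to,\leftrightarrow$ from a set of prime sentences that are written as finite bit strings (distinct prime sentences as distinct strings). Let $\mathcal S$ be the set of sentences. A *world* is a map $\mathbb W:\mathcal S\to\{0,1\}$; it is *propositionally consistent* if it respects the connectives. For $D\subseteq\mathcal S$ let $\mathcal{PC}(D)$ be the set of propositionally consistent worlds that assign $1$ to every element of $D$. A *market* is a computable sequence $\overline{\mathbb P}=(\mathbb P_1,\mathbb P_2,\dots)$ of functions $\mathbb P_n:\mathcal S\to\mathbb Q\cap[0,1]$. A *deductive process* is a computable nested sequence $\overline D=(D_1\subseteq D_2\subseteq\cdots)$ of finite subsets of $\mathcal S$; for a set $\Gamma\subseteq\mathcal S$ it is *$\Gamma$-complete* if $\mathcal{PC}(\bigcup_n D_n)=\mathcal{PC}(\Gamma)$. A sequence $(x_n)_{n\ge1}$ is *efficiently computable* if a Turing machine outputs $x_n$ on input $n$ in time polynomial in $n$. An *expressible feature of rank at most $n$* is an expression (in which intermediate variables may be defined and reused) built from the symbols $\phi^{*i}$ ($\phi\in\mathcal S$, $1\le i\le n$), whose value on a sequence $\overline{\mathbb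 V}$ is $\mathbb V_i(\phi)$, and from rational constants by addition, multiplication, $\max(-,-)$ and $x\mapsto 1/\max(1,x)$. A *trading strategy for day $n$* is a finite formal sum $T=\sum_j \xi_j\cdot(\phi_j-\phi_j^{*n})$ with $\phi_j\in\mathcal S$ and $\xi_j$ expressible features of rank at most $n$; its value in a world $\mathbb W$ when it is executed against $\overline{\mathbb V}$ is $\mathbb W(T(\overline{\mathbb V})):=\sum_j\xi_j(\overline{\mathbb V})\,(\mathbb W(\phi_j)-\mathbb V_n(\phi_j))$. A *trader* is a sequence $\overline T=(T_1,T_2,\dots)$, where $T_n$ is a trading strategy for day $n$. It *exploits* $\overline{\mathbb V}$ relative to $\overline D$ if the set $$\Big\{\textstyle\sum_{i\le n}\mathbb W\big(T_i(\overline{\mathbb V})\big)\;\Big|\; n\ge 1,\ \mathbb W\in\mathcal{PC}(D_n)\Big\}$$ is bounded below but not bounded above. A *logical inductor over $\Gamma$* is a market $\overline{\mathbb P}$ for which there is a $\Gamma$-complete deductive process $\overline D$ such that no efficiently computable trader exploits $\overline{\mathbb P}$ relative to $\overline D$. For $\mathbb V:\mathcal S\to[0,1]$ and $\psi\in\mathcal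 S$ put $\mathbb V(\phi\mid\psi):=\mathbb V(\phi\land\psi)/\mathbb V(\psi)$ if $\mathbb V(\phi\land\psi)<\mathbb V(\psi)$, and $\mathbb V(\phi\mid\psi):=1$ otherwise (in particular if $\mathbb V(\psi)=0$). **Theorem (Closure under conditioning).** Let $\Gamma\subseteq\mathcal S$ and let $\overline{\mathbb P}$ be a logical inductor over $\Gamma$. 1. For every sentence $\psi$, the sequence $\big(\mathbb P_1(-\mid\psi),\mathbb P_2(-\mid\psi),\dots\big)$ is a logical inductor over $\Gamma\cup\{\psi\}$. 2. For every efficiently computable sequence $(\psi_1,\psi_2,\dots)$ of sentences, the sequence $$\big(\mathbb P_1(-\mid\psi_1),\ \mathbb P_2(-\mid\psi_1\land\psi_2),\ \mathbb P_3(-\mid\psi_1\land\psi_2\land\psi_3),\ \dots\big),$$ whose $n$-th term is conditioned on the conjunction of the first $n$ sentences (bracketed to the left), is a logical inductor over $\Gamma\cup\{\psi_i\mid i\ge1\}$. -/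

import Mathlib

namespace LogicalInduction

/-! ### Sentences, worlds, theories -/

/-- Sentences of a propositional language whose prime sentences are the elements of `Atom`. -/
inductive Sentence (Atom : Type) : Type
  | atom (a : Atom) : Sentence Atom
  | neg (φ : Sentence Atom) : Sentence Atom
  | and (φ ψ : Sentence Atom) : Sentence Atom
  | or (φ ψ : Sentence Atom) : Sentence Atom
  | imp (φ ψ : Sentence Atom) : Sentence Atom
  | iff (φ ψ : Sentence Atom) : Sentence Atom

/-- A valuation assigns a real number to every sentence; the bounds `0 ≤ V φ ≤ 1` are imposed
where they are needed (see `IsMarket`). -/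
abbrev Valuation (Atom : Type) : Type := Sentence Atom → ℝ

/-- A world is any truth assignment to sentences, consistent or not. -/
abbrev World (Atom : Type) : Type := Sentence Atom → Bool

/-- A world seen as a valuation with values `0` and `1`. -/
noncomputable def World.toValuation {Atom : Type} (W : World Atom) : Valuation Atom :=
  fun φ => if W φ = true then 1 else 0

/-- A world is propositionally consistent if it respects the Boolean connectives. -/
structure World.PropConsistent {Atom : Type} (W : World Atom) : Prop where
  neg : ∀ φ, W (.neg φ) = !(W φ)
  and : ∀ φ ψ, W (.and φ ψ) = (W φ && W ψ)
  or : ∀ φ ψ, W (.or φ ψ) = (W φ || W ψ)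
  imp : ∀ φ ψ, W (.imp φ ψ) = (!(W φ) || W ψ)
  iff : ∀ φ ψ, W (.iff φ ψ) = (W φ == W ψ)

/-- The set of worlds that are propositionally consistent with the set of sentences `D`. -/
def pcWorlds {Atom : Type} (D : Set (Sentence Atom)) : Set (World Atom) :=
  {W | W.PropConsistent ∧ ∀ φ ∈ D, W φ = true}

/-! ### Expressible features, trading strategies

All sequences (days) are indexed by `ℕ`; index `n` stands for day `n + 1`. -/

/-- Feature expressions with variables: `price φ i` is the price of `φ` on day `i`, `var j` refers
to the `j`-th variable, and `safeInv e` is `1 / max(1, e)`. -/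
inductive FeatExpr (Atom : Type) : Type
  | price (φ : Sentence Atom) (i : ℕ) : FeatExpr Atom
  | const (q : ℚ) : FeatExpr Atom
  | var (j : ℕ) : FeatExpr Atom
  | add (e f : FeatExpr Atom) : FeatExpr Atom
  | mul (e f : FeatExpr Atom) : FeatExpr Atom
  | max (e f : FeatExpr Atom) : FeatExpr Atom
  | safeInv (e : FeatExpr Atom) : FeatExpr Atom

/-- Only prices up to and including day `n` and only the first `k` variables are mentioned. -/
def FeatExpr.WellFormed {Atom : Type} (n k : ℕ) : FeatExpr Atom → Prop
  | .price _ i => i ≤ n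
  | .const _ => True
  | .var j => j < k
  | .add e f => e.WellFormed n k ∧ f.WellFormed n k
  | .mul e f => e.WellFormed n k ∧ f.WellFormed n k
  | .max e f => e.WellFormed n k ∧ f.WellFormed n k
  | .safeInv e => e.WellFormed n k

/-- The value of a feature expression on a valuation sequence `V`, given the list `env` of the
values of the variables. -/
noncomputable def FeatExpr.eval {Atom : Type} (V : ℕ → Valuation Atom) (env : List ℝ) :
    FeatExpr Atom → ℝ
  | .price φ i => V i φ
  | .const q => (q : ℝ)
  | .var j => env.getD j 0
  | .add e f => e.eval V env + f.eval V env
  | .mul e f => e.eval V env * f.eval V env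
  | .max e f => Max.max (e.eval V env) (f.eval V env)
  | .safeInv e => 1 / Max.max 1 (e.eval V env)

/-- A written-down trading strategy: a list of variable definitions `v₀ := e₀, v₁ := e₁, …`,
followed by a list of pairs `(φ, ξ)`, each meaning "buy `ξ` shares of `φ` at the current price".
The cash term of the strategy is determined by these pairs. -/
structure Strategy (Atom : Type) : Type where
  defs : List (FeatExpr Atom)
  trades : List (Sentence Atom × FeatExpr Atom)

/-- `T` is a strategy for day `n`: all its features have rank at most `n`, and every definition
uses earlier variables only. -/
def Strategy.WellFormed {Atom : Type} (n : ℕ) (T : Strategy Atom) : Prop :=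
  (∀ (j : ℕ) (hj : j < T.defs.length), (T.defs[j]).WellFormed n j) ∧
    ∀ t ∈ T.trades, t.2.WellFormed n T.defs.length

/-- The values of the variables of `T` on the valuation sequence `V`, computed in order. -/
noncomputable def Strategy.env {Atom : Type} (T : Strategy Atom) (V : ℕ → Valuation Atom) :
    List ℝ :=
  T.defs.foldl (fun env e => env ++ [e.eval V env]) []

/-- The value according to `U` of the holdings `∑ ξᵢ(V) · (φᵢ - Vₙ(φᵢ))` that the strategy `T`
acquires when it is executed on day `n` against the valuation sequence `V`. -/
noncomputable def Strategy.value {Atom : Type} (T : Strategy Atom) (n : ℕ)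
    (V : ℕ → Valuation Atom) (U : Valuation Atom) : ℝ :=
  (T.trades.map fun t => t.2.eval V (T.env V) * (U t.1 - V n t.1)).sum

/-- A trader is a sequence of trading strategies, the `n`-th one being for day `n`. -/
def IsTrader {Atom : Type} (T : ℕ → Strategy Atom) : Prop :=
  ∀ n, (T n).WellFormed n

/-- The plausible assessments of the net worth of the trader `T` trading against `V`, relative to
the deductive process `D`. -/
def plausibleValues {Atom : Type} (T : ℕ → Strategy Atom) (V : ℕ → Valuation Atom)
    (D : ℕ → Finset (Sentence Atom)) : Set ℝ :=
  {x | ∃ (n : ℕ) (W : World Atom), W ∈ pcWorlds (D n : Set (Sentence Atom)) ∧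
    x = ∑ i ∈ Finset.range (n + 1), (T i).value i V W.toValuation}

/-- `T` exploits `V` relative to `D`. -/
def Exploits {Atom : Type} (T : ℕ → Strategy Atom) (V : ℕ → Valuation Atom)
    (D : ℕ → Finset (Sentence Atom)) : Prop :=
  BddBelow (plausibleValues T V D) ∧ ¬ BddAbove (plausibleValues T V D)

/-! ### Writing objects down as strings

Prime sentences are written as bit strings by a given injective map `code`; everything else is
written in prefix notation over a fixed finite alphabet. -/

/-- The alphabet. -/
inductive Sym : Type
  | b0 | b1 | tick | sep | minus
  | atom | neg | and | or | imp | iff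
  | price | const | var | add | mul | max | safeInv
  | define | trade
  deriving DecidableEq

instance : Fintype Sym where
  elems := {.b0, .b1, .tick, .sep, .minus, .atom, .neg, .and, .or, .imp, .iff, .price, .const,
    .var, .add, .mul, .max, .safeInv, .define, .trade}
  complete := by intro x; cases x <;> decide

/-- Unary notation. -/
def encUnary (n : ℕ) : List Sym := List.replicate n Sym.tick

def encBits (l : List Bool) : List Sym := l.map fun b => if b then Sym.b1 else Sym.b0

/-- Rational numbers: sign, numerator and denominator in binary. -/
def encRat (q : ℚ) : List Sym :=
  (if q < 0 then [Sym.minus] else []) ++ encBits q.num.natAbs.bits ++ [Sym.sep] ++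
    encBits q.den.bits ++ [Sym.sep]

def encSentence {Atom : Type} (code : Atom → List Bool) : Sentence Atom → List Sym
  | .atom a => Sym.atom :: (encBits (code a) ++ [Sym.sep])
  | .neg φ => Sym.neg :: encSentence code φ
  | .and φ ψ => Sym.and :: (encSentence code φ ++ encSentence code ψ)
  | .or φ ψ => Sym.or :: (encSentence code φ ++ encSentence code ψ)
  | .imp φ ψ => Sym.imp :: (encSentence code φ ++ encSentence code ψ)
  | .iff φ ψ => Sym.iff :: (encSentence code φ ++ encSentence code ψ)

def encFeatExpr {Atom : Type} (code : Atom → List Bool) : FeatExpr Atom → List Sym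
  | .price φ i => Sym.price :: (encSentence code φ ++ encUnary i ++ [Sym.sep])
  | .const q => Sym.const :: encRat q
  | .var j => Sym.var :: (encUnary j ++ [Sym.sep])
  | .add e f => Sym.add :: (encFeatExpr code e ++ encFeatExpr code f)
  | .mul e f => Sym.mul :: (encFeatExpr code e ++ encFeatExpr code f)
  | .max e f => Sym.max :: (encFeatExpr code e ++ encFeatExpr code f)
  | .safeInv e => Sym.safeInv :: encFeatExpr code e

def encStrategy {Atom : Type} (code : Atom → List Bool) (T : Strategy Atom) : List Sym :=
  (T.defs.flatMap fun e => Sym.define :: encFeatExpr code e) ++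
    T.trades.flatMap fun t => Sym.trade :: (encSentence code t.1 ++ encFeatExpr code t.2)

def encSentenceList {Atom : Type} (code : Atom → List Bool) (l : List (Sentence Atom)) :
    List Sym :=
  l.flatMap fun φ => Sym.sep :: encSentence code φ

/-- A day together with a sentence. -/
def encDaySentence {Atom : Type} (code : Atom → List Bool) (x : ℕ × Sentence Atom) : List Sym :=
  encUnary x.1 ++ Sym.sep :: encSentence code x.2

/-- A pair of natural numbers. -/
def encPair (x : ℕ × ℕ) : List Sym := encUnary x.1 ++ Sym.sep :: encUnary x.2

/-! ### Computability, and efficient computability by Turing machines -/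

/-- A Turing machine computes `f`, where inputs and outputs are written by `ea` and `eb`. -/
def TMComputable {α β : Type} (ea : α → List Sym) (eb : β → List Sym) (f : α → β) : Prop :=
  Nonempty (Turing.TM2Computable ea eb f)

/-- The sequence `x`, whose terms are written by `e`, is efficiently computable: a Turing machine
outputs `x n` on input `n` in time polynomial in `n` (that is, in the length of `n` in unary). -/
def EffComputable {β : Type} (e : β → List Sym) (x : ℕ → β) : Prop :=
  Nonempty (Turing.TM2ComputableInPolyTime encUnary e x)

/-! ### Markets, deductive processes, logical inductors -/

/-- A market: a computable sequence of pricings with rational values in `[0, 1]`. A price is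
computed as a fraction, not necessarily in lowest terms. -/
def IsMarket {Atom : Type} (code : Atom → List Bool) (P : ℕ → Valuation Atom) : Prop :=
  (∀ n φ, 0 ≤ P n φ ∧ P n φ ≤ 1) ∧
    ∃ r : ℕ × Sentence Atom → ℕ × ℕ, TMComputable (encDaySentence code) encPair r ∧
      ∀ n φ, (r (n, φ)).2 ≠ 0 ∧ P n φ = ((r (n, φ)).1 : ℝ) / ((r (n, φ)).2 : ℝ)

/-- A deductive process: a computable nested sequence of finite sets of sentences. -/
def IsDeductiveProcess {Atom : Type} (code : Atom → List Bool)
    (D : ℕ → Finset (Sentence Atom)) : Prop :=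
  Monotone D ∧
    ∃ l : ℕ → List (Sentence Atom), TMComputable encUnary (encSentenceList code) l ∧
      ∀ n φ, φ ∈ D n ↔ φ ∈ l n

/-- The deductive process `D` is `Γ`-complete. -/
def IsCompleteFor {Atom : Type} (D : ℕ → Finset (Sentence Atom)) (Γ : Set (Sentence Atom)) :
    Prop :=
  pcWorlds (⋃ n, (D n : Set (Sentence Atom))) = pcWorlds Γ

/-- The market `P` satisfies the logical induction criterion relative to the deductive
process `D`. -/
def IsLogicalInductorRel {Atom : Type} (code : Atom → List Bool) (P : ℕ → Valuation Atom)
    (D : ℕ → Finset (Sentence Atom)) : Prop :=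
  IsMarket code P ∧ IsDeductiveProcess code D ∧
    ¬ ∃ T : ℕ → Strategy Atom,
      IsTrader T ∧ EffComputable (encStrategy code) T ∧ Exploits T P D

/-- `P` is a logical inductor over the theory `Γ`. -/
def IsLogicalInductorOver {Atom : Type} (code : Atom → List Bool) (P : ℕ → Valuation Atom)
    (Γ : Set (Sentence Atom)) : Prop :=
  ∃ D : ℕ → Finset (Sentence Atom), IsCompleteFor D Γ ∧ IsLogicalInductorRel code P D

/-! ### Conditioning -/

/-- The conditional valuation `V(- | ψ)`, capped at `1`; it is `1` when `V ψ = 0`. -/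
noncomputable def Valuation.cond {Atom : Type} (V : Valuation Atom) (ψ : Sentence Atom) :
    Valuation Atom :=
  fun φ => if V (.and φ ψ) < V ψ then V (.and φ ψ) / V ψ else 1

/-- The conjunction `(⋯((ψ₀ ∧ ψ₁) ∧ ψ₂) ⋯) ∧ ψₙ` of the sentences up to index `n`. -/
def conjUpTo {Atom : Type} (ψ : ℕ → Sentence Atom) : ℕ → Sentence Atom
  | 0 => ψ 0
  | n + 1 => .and (conjUpTo ψ n) (ψ (n + 1))

end LogicalInduction

/-! Both claims are cases of one statement. Let `χ 0, χ 1, …` be an efficiently computable sequence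
in which each sentence propositionally implies its predecessor. Let Q be the market that conditions
P on `χ n` on day `n`, and let D' be D with `χ 0, …, χ n` added by day `n`. If an efficient trader T
exploits Q relative to D', then some efficient trader exploits P relative to D
(`IsLogicalInductorOver.cond`).

Buying ξ shares of φ at price P(φ|χ) is imitated by buying ξ shares of φ∧χ and selling ξ·P(φ|χ)
shares of χ. As long as P(φ∧χ) ≤ P(χ), the payments cancel, and the holding is worth what T's is if
χ is true and nothing if χ is false. If P(φ∧χ) > P(χ), the conditional price is capped at 1 and a
purchase loses money on P; but buying at price 1 never profits T either, so the purchase can be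
scaled down until its loss is negligible (`reduced_trade_ge`), and the losses are made summable.
Once some `χ m` fails in a world, all later trades count 0 there, so the worth is that of T on an
earlier day in a world still plausible for D', up to a constant. Hence exploitation carries over
(`Exploits.condition`).

Features allow division only in the form 1/max(1,x). The quotient P(φ∧χ)/P(χ) is therefore
expressible only if, for a fixed `c`, each price of `χ n` on day `n` is 0 or at least 1/c; this `c`
is wired into the trader and need not be computed. If there is no such `c`, positive prices of `χ n`
come arbitrarily close to 0. Then a second trader buys `χ n` below a limit that shrinks with every
purchase: it spends at most 2 (`sum_shares_mul_le`), yet collects unboundedly many shares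
(`tendsto_sum_shares`), all worth 1 in the worlds of PC(D'_n). Such worlds exist for every `n`
because T exploits Q relative to D' (`Exploits.exists_mem_pcWorlds`, `buyer_exploits`).

The remaining work is efficiency. Programs in a small language with calls are compiled to stack
machines (`reachesIn_compile`). Because strategies are written in prefix notation, one pass from
right to left turns T into its imitation (`foldr_encStrategy`, `exec_rewrite`), and a similar
program computes the conditional market (`runs_condMarket`). -/

/-! ### Part: a programming language and its compilation to stack machines. -/

namespace LogicalInduction
open Turing

/-! ### Runs of machines -/

/-- Iterating the partial map `f` leads from `a` to `b` in at most `t` steps. -/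
def ReachesIn {σ : Type*} (f : σ → Option σ) (a b : σ) (t : ℕ) : Prop :=
  ∃ n ≤ t, (flip bind f)^[n] (some a) = some b

theorem ReachesIn.refl {σ : Type*} (f : σ → Option σ) (a : σ) (t : ℕ) : ReachesIn f a a t :=
  ⟨0, t.zero_le, rfl⟩

theorem ReachesIn.trans {σ : Type*} {f : σ → Option σ} {a b c : σ} {s t : ℕ}
    (h₁ : ReachesIn f a b s) (h₂ : ReachesIn f b c t) : ReachesIn f a c (s + t) := by
  obtain ⟨m, hm, h₁⟩ := h₁
  obtain ⟨n, hn, h₂⟩ := h₂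
  exact ⟨n + m, by omega, by rw [Function.iterate_add_apply, h₁, h₂]⟩

theorem ReachesIn.mono {σ : Type*} {f : σ → Option σ} {a b : σ} {s t : ℕ}
    (h : ReachesIn f a b s) (hst : s ≤ t) : ReachesIn f a b t := by
  obtain ⟨m, hm, h⟩ := h
  exact ⟨m, hm.trans hst, h⟩

theorem ReachesIn.single {σ : Type*} {f : σ → Option σ} {a b : σ} (h : f a = some b) :
    ReachesIn f a b 1 :=
  ⟨1, le_rfl, h⟩

/-- A machine that reads and writes strings over the fixed alphabet. -/
abbrev Machine : Type 1 := TM2ComputableAux Sym Sym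

/-- The machine `M` outputs `y` on input `x` in at most `t` steps. -/
def Outputs (M : Machine) (x y : List Sym) (t : ℕ) : Prop :=
  ReachesIn M.tm.step (initList M.tm (x.map M.inputAlphabet.invFun))
    (haltList M.tm (y.map M.outputAlphabet.invFun)) t

/-! ### A small programming language -/

/-- Programs over registers `ι` that hold strings and may call machines named by `q`.
`pop i f` removes the first symbol of register `i` and branches on it; `loop i f` does so until the
register is empty; `call a i j` runs machine `a` on the reversed contents of register `i` and puts
its reversed output in front of register `j`. -/
inductive Cmd (ι q : Type) : Type
  | skip : Cmd ι q
  | push (i : ι) (a : Sym) : Cmd ι q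
  | seq (c d : Cmd ι q) : Cmd ι q
  | pop (i : ι) (f : Option Sym → Cmd ι q) : Cmd ι q
  | loop (i : ι) (f : Sym → Cmd ι q) : Cmd ι q
  | call (a : q) (i j : ι) : Cmd ι q

section Language

variable {ι q : Type} [DecidableEq ι]

/-- `Exec O c S S' t`: the program `c` turns the registers `S` into `S'` in at most `t` steps. -/
inductive Exec (O : q → Machine) :
    Cmd ι q → (ι → List Sym) → (ι → List Sym) → ℕ → Prop
  | skip (S t) : Exec O .skip S S t
  | push (i a S t) (ht : 1 ≤ t) : Exec O (.push i a) S (Function.update S i (a :: S i)) t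
  | seq {c d S S₁ S₂ s t r} (h₁ : Exec O c S S₁ s) (h₂ : Exec O d S₁ S₂ t) (hr : s + t ≤ r) :
      Exec O (.seq c d) S S₂ r
  | pop {i f S S' s t} (h : Exec O (f (S i).head?) (Function.update S i (S i).tail) S' s)
      (ht : s + 1 ≤ t) : Exec O (.pop i f) S S' t
  | loop_nil {i f S t} (h : S i = []) (ht : 1 ≤ t) : Exec O (.loop i f) S S t
  | loop_cons {i f S S₁ S₂ a l r s t} (h : S i = a :: l)
      (h₁ : Exec O (f a) (Function.update S i l) S₁ r) (h₂ : Exec O (.loop i f) S₁ S₂ s)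
      (ht : r + s + 1 ≤ t) : Exec O (.loop i f) S S₂ t
  | call {a i j S x y r t} (h : S i = x.reverse) (ho : Outputs (O a) x y r)
      (ht : x.length + r + y.length + 2 ≤ t) :
      Exec O (.call a i j) S (Function.update (Function.update S i []) j
        (y.reverse ++ Function.update S i [] j)) t

variable (ι) in
/-- The stacks of the machine that executes programs. -/
abbrev Stacks (O : q → Machine) : Type := ι ⊕ (a : q) × (O a).tm.K

/-- Stack alphabets. -/
abbrev Alph (O : q → Machine) : Stacks ι O → Type
  | .inl _ => Sym
  | .inr k => (O k.1).tm.Γ k.2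

/-- Internal states: the last symbol read, and the internal states of the machines called. -/
abbrev Ctl (O : q → Machine) : Type := Option Sym × ∀ a, (O a).tm.σ

/-- The initial internal states of the machines called. -/
def idle (O : q → Machine) : ∀ a, (O a).tm.σ := fun a => (O a).tm.initialState

/-- The labels of the compiled program. -/
def Label (O : q → Machine) : Cmd ι q → Type
  | .skip => Empty
  | .push _ _ => Unit
  | .seq c d => Label O c ⊕ Label O d
  | .pop _ f => Option ((a : Option Sym) × Label O (f a))
  | .loop _ f => Option ((a : Sym) × Label O (f a))
  | .call a _ _ => Bool ⊕ (O a).tm.Λ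

instance (O : q → Machine) (a : q) : Finite (O a).tm.Λ :=
  haveI := (O a).tm.ΛFin; inferInstance

theorem Label.finite (O : q → Machine) (c : Cmd ι q) : Finite (Label O c) := by
  induction c with
  | skip => unfold Label; infer_instance
  | push => unfold Label; infer_instance
  | seq c d hc hd => unfold Label; infer_instance
  | pop i f hf => unfold Label; infer_instance
  | loop i f hf => unfold Label; infer_instance
  | call => unfold Label; infer_instance

section Compile

variable [DecidableEq q] (O : q → Machine) {Λ : Type}

/-- Statements of a called machine as statements of the calling machine. -/
def liftStmt (a : q) (emb : (O a).tm.Λ → Λ) (exit : Λ) :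
    TM2.Stmt (O a).tm.Γ (O a).tm.Λ (O a).tm.σ → TM2.Stmt (Alph (ι := ι) O) Λ (Ctl O)
  | .push k f s => .push (.inr ⟨a, k⟩) (fun v => f (v.2 a)) (liftStmt a emb exit s)
  | .peek k f s => .peek (.inr ⟨a, k⟩)
      (fun v x => (v.1, Function.update v.2 a (f (v.2 a) x))) (liftStmt a emb exit s)
  | .pop k f s => .pop (.inr ⟨a, k⟩)
      (fun v x => (v.1, Function.update v.2 a (f (v.2 a) x))) (liftStmt a emb exit s)
  | .load f s => .load (fun v => (v.1, Function.update v.2 a (f (v.2 a)))) (liftStmt a emb exit s)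
  | .branch f s t => .branch (fun v => f (v.2 a)) (liftStmt a emb exit s) (liftStmt a emb exit t)
  | .goto l => .goto fun v => emb (l (v.2 a))
  | .halt => .goto fun _ => exit

/-- The first label of the compiled program `c`, when execution continues at `next` afterwards. -/
def entry (c : Cmd ι q) (emb : Label O c → Λ) (next : Λ) : Λ :=
  match c with
  | .skip => next
  | .push _ _ => emb ()
  | .seq c d => entry c (emb ∘ .inl) (entry d (emb ∘ .inr) next)
  | .pop _ _ => emb none
  | .loop _ _ => emb none
  | .call _ _ _ => emb (.inl true)

/-- The compiled program. -/
def compile (c : Cmd ι q) (emb : Label O c → Λ) (next : Λ) :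
    Label O c → TM2.Stmt (Alph (ι := ι) O) Λ (Ctl O) :=
  match c with
  | .skip => fun l => l.elim
  | .push i a => fun _ => .push (.inl i) (fun _ => a) (.goto fun _ => next)
  | .seq c d => fun
    | .inl l => compile c (emb ∘ .inl) (entry O d (emb ∘ .inr) next) l
    | .inr l => compile d (emb ∘ .inr) next l
  | .pop i f => fun
    | none => .pop (.inl i) (fun v x => (x, v.2))
        (.goto fun v => entry O (f v.1) (fun l => emb (some ⟨v.1, l⟩)) next)
    | some ⟨a, l⟩ => compile (f a) (fun l => emb (some ⟨a, l⟩)) next l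
  | .loop i f => fun
    | none => .pop (.inl i) (fun v x => (x, v.2)) (.goto fun v => match v.1 with
        | none => next
        | some a => entry O (f a) (fun l => emb (some ⟨a, l⟩)) (emb none))
    | some ⟨a, l⟩ => compile (f a) (fun l => emb (some ⟨a, l⟩)) (emb none) l
  | .call a i j => fun
    | .inl true => .pop (.inl i) (fun v x => (x, v.2)) (.branch (fun v => v.1.isSome)
        (.push (.inr ⟨a, (O a).tm.k₀⟩) (fun v => (O a).inputAlphabet.invFun (v.1.getD .tick))
          (.goto fun _ => emb (.inl true)))
        (.goto fun _ => emb (.inr (O a).tm.main)))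
    | .inl false => .pop (.inr ⟨a, (O a).tm.k₁⟩)
        (fun v x => (x.map (O a).outputAlphabet.toFun, v.2)) (.branch (fun v => v.1.isSome)
        (.push (.inl j) (fun v => v.1.getD .tick) (.goto fun _ => emb (.inl false)))
        (.goto fun _ => next))
    | .inr l => liftStmt O a (emb ∘ .inr) (emb (.inl false)) ((O a).tm.m l)

/-- Stacks with given registers and with stacks `R` for the machine `a`. -/
def calling (S : ι → List Sym) (a : q) (R : ∀ k, List ((O a).tm.Γ k)) :
    ∀ k : Stacks ι O, List (Alph O k)
  | .inl i => S i
  | .inr ⟨b, k⟩ => if h : a = b then by subst h; exact R k else []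

/-- Stacks with given registers, the stacks of the machines called being empty. -/
def regs (S : ι → List Sym) : ∀ k : Stacks ι O, List (Alph O k)
  | .inl i => S i
  | .inr _ => []

theorem calling_nil (S : ι → List Sym) (a : q) : calling O S a (fun _ => []) = regs O S := by
  funext k
  rcases k with i | ⟨b, k⟩
  · rfl
  · by_cases h : a = b
    · subst h; simp [calling, regs]
    · simp [calling, regs, h]

theorem update_regs (S : ι → List Sym) (i : ι) (l : List Sym) :
    Function.update (regs O S) (.inl i) l = regs O (Function.update S i l) := by
  funext k
  rcases k with j | k
  · by_cases h : j = i
    · subst h; simp [regs]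
    · have : (Sum.inl j : Stacks ι O) ≠ .inl i := by simpa using h
      rw [Function.update_of_ne this]
      simp [regs, h]
  · rw [Function.update_of_ne (by simp)]; rfl

theorem update_calling_inl (S : ι → List Sym) (a : q) (R : ∀ k, List ((O a).tm.Γ k))
    (i : ι) (l : List Sym) :
    Function.update (calling O S a R) (.inl i) l = calling O (Function.update S i l) a R := by
  funext k
  rcases k with j | k
  · by_cases h : j = i
    · subst h; simp [calling]
    · have : (Sum.inl j : Stacks ι O) ≠ .inl i := by simpa using h
      rw [Function.update_of_ne this]
      simp [calling, h]
  · rw [Function.update_of_ne (by simp)]; rfl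

theorem calling_inr (S : ι → List Sym) (a : q) (R : ∀ k, List ((O a).tm.Γ k)) (k : (O a).tm.K) :
    calling O S a R (.inr ⟨a, k⟩) = R k := by
  simp [calling]

theorem update_calling_inr (S : ι → List Sym) (a : q) (R : ∀ k, List ((O a).tm.Γ k))
    (k : (O a).tm.K) (l : List ((O a).tm.Γ k)) :
    Function.update (calling O S a R) (.inr ⟨a, k⟩) l = calling O S a (Function.update R k l) := by
  funext k'
  rcases k' with j | ⟨b, k'⟩
  · rw [Function.update_of_ne (by simp)]; rfl
  · by_cases h : a = b
    · subst h
      by_cases hk : k' = k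
      · subst hk; simp [calling]
      · have : (Sum.inr ⟨a, k'⟩ : Stacks ι O) ≠ .inr ⟨a, k⟩ := by simpa using hk
        rw [Function.update_of_ne this]
        simp [calling, hk]
    · have : (Sum.inr ⟨b, k'⟩ : Stacks ι O) ≠ .inr ⟨a, k⟩ := by
        intro e; simp at e; exact h e.1.symm
      rw [Function.update_of_ne this]
      simp [calling, h]

/-- Configurations of a called machine as configurations of the calling machine. -/
def liftCfg (S : ι → List Sym) (r : Option Sym) (a : q) (emb : (O a).tm.Λ → Λ) (exit : Λ)
    (c : TM2.Cfg (O a).tm.Γ (O a).tm.Λ (O a).tm.σ) : TM2.Cfg (Alph (ι := ι) O) Λ (Ctl O) :=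
  ⟨some (c.l.elim exit emb), (r, Function.update (idle O) a c.var), calling O S a c.stk⟩

/-- A lifted statement touches only the internal state and the stacks of `a`, so the simulation is
step by step. `halt` becomes a jump to `exit`, which is why `liftCfg` gives halted configurations
that label. -/
theorem stepAux_liftStmt (S : ι → List Sym) (r : Option Sym) (a : q) (emb : (O a).tm.Λ → Λ)
    (exit : Λ) (s : TM2.Stmt (O a).tm.Γ (O a).tm.Λ (O a).tm.σ) :
    ∀ v R, TM2.stepAux (liftStmt O a emb exit s) (r, Function.update (idle O) a v) (calling O S a R) =
      liftCfg O S r a emb exit (TM2.stepAux s v R) := by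
  induction s with
  | push k f s ih =>
    intro v R
    simp only [liftStmt, TM2.stepAux]
    rw [← ih, ← update_calling_inr, calling_inr]
    simp
  | peek k f s ih =>
    intro v R
    simp only [liftStmt, TM2.stepAux]
    rw [← ih, calling_inr]
    simp
  | pop k f s ih =>
    intro v R
    simp only [liftStmt, TM2.stepAux]
    rw [← ih, ← update_calling_inr, calling_inr]
    simp
  | load f s ih =>
    intro v R
    simp only [liftStmt, TM2.stepAux]
    rw [← ih]
    simp
  | branch f s t ihs iht =>
    intro v R
    simp only [liftStmt, TM2.stepAux]
    rw [ihs, iht]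
    simp only [Function.update_self]
    cases f v <;> rfl
  | goto l => intro v R; simp [liftStmt, TM2.stepAux, liftCfg]
  | halt => intro v R; simp [liftStmt, TM2.stepAux, liftCfg]

theorem reachesIn_liftCfg (S : ι → List Sym) (r : Option Sym) (a : q) (emb : (O a).tm.Λ → Λ)
    (exit : Λ) (m : Λ → TM2.Stmt (Alph (ι := ι) O) Λ (Ctl O))
    (hm : ∀ l, m (emb l) = liftStmt O a emb exit ((O a).tm.m l)) {c d : (O a).tm.Cfg} {t : ℕ}
    (h : ReachesIn (O a).tm.step c d t) :
    ReachesIn (TM2.step m) (liftCfg O S r a emb exit c) (liftCfg O S r a emb exit d) t := by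
  obtain ⟨n, hn, h⟩ := h
  refine ReachesIn.mono ?_ hn
  clear hn
  induction n generalizing c with
  | zero =>
    simp only [Function.iterate_zero, id, Option.some.injEq] at h
    subst h
    exact ReachesIn.refl _ _ _
  | succ n ih =>
    rw [Function.iterate_succ_apply] at h
    have hstep : flip bind (O a).tm.step (some c) = (O a).tm.step c := rfl
    rw [hstep] at h
    rcases hc : (O a).tm.step c with _ | c'
    -- Once halted, the iteration stays at `none` and cannot arrive at `d`.
    · exfalso
      rw [hc] at h
      have : ∀ k, (flip bind (O a).tm.step)^[k] none = none := by
        intro k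
        induction k with
        | zero => rfl
        | succ k ih => rw [Function.iterate_succ_apply]; exact ih
      rw [this] at h
      exact absurd h (by simp)
    · rw [hc] at h
      rw [add_comm]
      refine ReachesIn.trans (ReachesIn.single ?_) (ih h)
      obtain ⟨l, v, R⟩ := c
      cases l with
      | none => exact absurd hc (by simp [TM2.step])
      | some l =>
        have hc' : TM2.stepAux ((O a).tm.m l) v R = c' := Option.some.inj hc
        rw [← hc', ← stepAux_liftStmt O S r a emb exit ((O a).tm.m l) v R, ← hm]
        rfl

theorem initList_stk (M : FinTM2) (l : List (M.Γ M.k₀)) :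
    (initList M l).stk = Function.update (fun _ => []) M.k₀ l := by
  funext k
  by_cases h : k = M.k₀
  · subst h; simp [initList]
  · simp [initList, h]

theorem haltList_stk (M : FinTM2) (l : List (M.Γ M.k₁)) :
    (haltList M l).stk = Function.update (fun _ => []) M.k₁ l := by
  funext k
  by_cases h : k = M.k₁
  · subst h; simp [haltList]
  · simp [haltList, h]

variable {O}

theorem compile_pop (i : ι) (f : Option Sym → Cmd ι q) (emb : Label O (.pop i f) → Λ) (next : Λ) :
    compile O (.pop i f) emb next none = .pop (.inl i) (fun v x => (x, v.2))
      (.goto fun v => entry O (f v.1) (fun l => emb (some ⟨v.1, l⟩)) next) := by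
  rw [compile]

theorem compile_pop_some (i : ι) (f : Option Sym → Cmd ι q) (emb : Label O (.pop i f) → Λ)
    (next : Λ) (a : Option Sym) (l : Label O (f a)) :
    compile O (.pop i f) emb next (some ⟨a, l⟩) =
      compile O (f a) (fun l => emb (some ⟨a, l⟩)) next l := by
  rw [compile]

theorem compile_loop (i : ι) (f : Sym → Cmd ι q) (emb : Label O (.loop i f) → Λ) (next : Λ) :
    compile O (.loop i f) emb next none = .pop (.inl i) (fun v x => (x, v.2))
      (.goto fun v => match v.1 with
        | none => next
        | some a => entry O (f a) (fun l => emb (some ⟨a, l⟩)) (emb none)) := by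
  rw [compile]

theorem compile_loop_some (i : ι) (f : Sym → Cmd ι q) (emb : Label O (.loop i f) → Λ)
    (next : Λ) (a : Sym) (l : Label O (f a)) :
    compile O (.loop i f) emb next (some ⟨a, l⟩) =
      compile O (f a) (fun l => emb (some ⟨a, l⟩)) (emb none) l := by
  rw [compile]

theorem compile_call_load (a : q) (i j : ι) (emb : Label O (.call a i j) → Λ) (next : Λ) :
    compile O (.call a i j) emb next (.inl true) =
      .pop (.inl i) (fun v x => (x, v.2)) (.branch (fun v => v.1.isSome)
        (.push (.inr ⟨a, (O a).tm.k₀⟩) (fun v => (O a).inputAlphabet.invFun (v.1.getD .tick))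
          (.goto fun _ => emb (.inl true)))
        (.goto fun _ => emb (.inr (O a).tm.main))) := by
  rw [compile]

theorem compile_call_unload (a : q) (i j : ι) (emb : Label O (.call a i j) → Λ) (next : Λ) :
    compile O (.call a i j) emb next (.inl false) = .pop (.inr ⟨a, (O a).tm.k₁⟩)
        (fun v x => (x.map (O a).outputAlphabet.toFun, v.2)) (.branch (fun v => v.1.isSome)
        (.push (.inl j) (fun v => v.1.getD .tick) (.goto fun _ => emb (.inl false)))
        (.goto fun _ => next)) := by
  rw [compile]

theorem compile_call_run (a : q) (i j : ι) (emb : Label O (.call a i j) → Λ) (next : Λ)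
    (l : (O a).tm.Λ) :
    compile O (.call a i j) emb next (.inr l) =
      liftStmt O a (emb ∘ .inr) (emb (.inl false)) ((O a).tm.m l) := by
  rw [compile]

/-- Passing symbols from one stack to another reverses them; `w` holds the symbols already passed,
so that the induction on `x` goes through. The extra step is the pop that finds the register empty.
-/
theorem reachesIn_load (m : Λ → TM2.Stmt (Alph (ι := ι) O) Λ (Ctl O)) {a : q} {i j : ι}
    {emb : Label O (.call a i j) → Λ} {next : Λ}
    (hm : ∀ l, m (emb l) = compile O (.call a i j) emb next l) (x : List Sym) :
    ∀ (S : ι → List Sym) (r : Option Sym) (w : List ((O a).tm.Γ (O a).tm.k₀)), S i = x →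
      ReachesIn (TM2.step m)
        ⟨some (emb (.inl true)), (r, idle O),
          calling O S a (Function.update (fun _ => []) (O a).tm.k₀ w)⟩
        ⟨some (emb (.inr (O a).tm.main)), (none, idle O),
          calling O (Function.update S i []) a (Function.update (fun _ => []) (O a).tm.k₀
            (x.reverse.map (O a).inputAlphabet.invFun ++ w))⟩ (x.length + 1) := by
  induction x with
  | nil =>
    intro S r w hx
    refine ReachesIn.single ?_
    have : Function.update S i [] = S := by rw [← hx, Function.update_eq_self]
    simp only [TM2.step, (hm _).trans (compile_call_load ..), TM2.stepAux, update_calling_inl]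
    simp [calling, hx, this]
  | cons b x ih =>
    intro S r w hx
    rw [List.length_cons, add_comm]
    have h := ih (Function.update S i x) (some b) ((O a).inputAlphabet.invFun b :: w) (by simp)
    rw [Function.update_idem] at h
    have e : (b :: x).reverse.map (O a).inputAlphabet.invFun ++ w =
        x.reverse.map (O a).inputAlphabet.invFun ++ (O a).inputAlphabet.invFun b :: w := by simp
    rw [e]
    refine (ReachesIn.single ?_).trans h
    simp only [TM2.step, (hm _).trans (compile_call_load ..), TM2.stepAux, update_calling_inl,
      update_calling_inr, calling_inr]
    simp [calling, hx]

theorem reachesIn_unload (m : Λ → TM2.Stmt (Alph (ι := ι) O) Λ (Ctl O)) {a : q} {i j : ι}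
    {emb : Label O (.call a i j) → Λ} {next : Λ}
    (hm : ∀ l, m (emb l) = compile O (.call a i j) emb next l) (y : List Sym) :
    ∀ (S : ι → List Sym) (r : Option Sym),
      ReachesIn (TM2.step m)
        ⟨some (emb (.inl false)), (r, idle O),
          calling O S a (Function.update (fun _ => []) (O a).tm.k₁
            (y.map (O a).outputAlphabet.invFun))⟩
        ⟨some next, (none, idle O), regs O (Function.update S j (y.reverse ++ S j))⟩
        (y.length + 1) := by
  induction y with
  | nil =>
    intro S r
    refine ReachesIn.single ?_
    simp only [TM2.step, (hm _).trans (compile_call_unload ..), TM2.stepAux, update_calling_inr, calling_inr]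
    simp [calling_nil, Function.update_eq_self]
  | cons b y ih =>
    intro S r
    rw [List.length_cons, add_comm]
    have h := ih (Function.update S j (b :: S j)) (some b)
    rw [Function.update_idem, Function.update_self] at h
    have e : (b :: y).reverse ++ S j = y.reverse ++ b :: S j := by simp
    rw [e]
    refine (ReachesIn.single ?_).trans h
    simp only [TM2.step, (hm _).trans (compile_call_unload ..), TM2.stepAux, update_calling_inl,
      update_calling_inr, calling_inr]
    simp [calling]

/-- Correctness of the compiler. Subprograms live in the same machine under other embeddings and
continuations, hence the quantifiers over `emb` and `next`. The symbol last read is left arbitrary,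
but the called machines return to `idle` with empty stacks, because `haltList` restores the initial
state; this allows repeated calls. -/
theorem reachesIn_compile {c : Cmd ι q} {S S' : ι → List Sym} {t : ℕ} (h : Exec O c S S' t)
    (m : Λ → TM2.Stmt (Alph (ι := ι) O) Λ (Ctl O)) :
    ∀ (emb : Label O c → Λ) (next : Λ), (∀ l, m (emb l) = compile O c emb next l) →
      ∀ r, ∃ r', ReachesIn (TM2.step m) ⟨some (entry O c emb next), (r, idle O), regs O S⟩
        ⟨some next, (r', idle O), regs O S'⟩ t := by
  induction h with
  | skip S t => exact fun emb next hm r => ⟨r, ReachesIn.refl _ _ _⟩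
  | push i a S t ht =>
    refine fun emb next hm r => ⟨r, (ReachesIn.single ?_).mono ht⟩
    simp only [TM2.step, hm (), compile, entry, TM2.stepAux, update_regs]
    simp [regs]
  | seq h₁ h₂ hr ih₁ ih₂ =>
    intro emb next hm r
    obtain ⟨r₁, h₁⟩ := ih₁ (emb ∘ .inl) _ (fun l => hm (.inl l)) r
    obtain ⟨r₂, h₂⟩ := ih₂ (emb ∘ .inr) next (fun l => hm (.inr l)) r₁
    exact ⟨r₂, (h₁.trans h₂).mono hr⟩
  | @pop i f S S' s t h ht ih =>
    intro emb next hm r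
    obtain ⟨r', h'⟩ := ih (fun l => emb (some ⟨_, l⟩)) next (fun l => (hm (some ⟨_, l⟩)).trans (compile_pop_some ..)) (S i).head?
    refine ⟨r', ((ReachesIn.single ?_).trans h').mono (by omega)⟩
    simp only [TM2.step, (hm _).trans (compile_pop ..), entry, TM2.stepAux, update_regs]
    simp [regs]
  | @loop_nil i f S t h ht =>
    refine fun emb next hm r => ⟨none, (ReachesIn.single ?_).mono ht⟩
    have : Function.update S i [] = S := by rw [← h, Function.update_eq_self]
    simp only [TM2.step, (hm _).trans (compile_loop ..), entry, TM2.stepAux, update_regs]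
    simp [regs, h, this]
  | @loop_cons i f S S₁ S₂ a l r s t h h₁ h₂ ht ih₁ ih₂ =>
    intro emb next hm v
    obtain ⟨r₁, h₁⟩ := ih₁ (fun l => emb (some ⟨_, l⟩)) (emb none) (fun l => (hm (some ⟨_, l⟩)).trans (compile_loop_some ..))
      (some a)
    obtain ⟨r₂, h₂⟩ := ih₂ emb next hm r₁
    refine ⟨r₂, ((ReachesIn.single ?_).trans (h₁.trans h₂)).mono (by omega)⟩
    simp only [TM2.step, (hm _).trans (compile_loop ..), entry, TM2.stepAux, update_regs]
    simp [regs, h]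
  | @call a i j S x y r t h ho ht =>
    intro emb next hm v
    have h₁ := reachesIn_load m hm x.reverse S v [] h
    have h₂ := reachesIn_liftCfg O (Function.update S i []) none a (emb ∘ .inr) (emb (.inl false)) m
      (fun l => (hm (.inr l)).trans (compile_call_run ..)) ho
    have h₃ := reachesIn_unload m hm y (Function.update S i []) none
    simp only [List.length_reverse, List.reverse_reverse, List.append_nil] at h₁
    have e₁ : liftCfg O (Function.update S i []) none a (emb ∘ .inr) (emb (.inl false))
        (initList (O a).tm (x.map (O a).inputAlphabet.invFun)) =
        ⟨some (emb (.inr (O a).tm.main)), (none, idle O), calling O (Function.update S i []) a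
          (Function.update (fun _ => []) (O a).tm.k₀ (x.map (O a).inputAlphabet.invFun))⟩ := by
      refine (congrArg (TM2.Cfg.mk _ _) (congrArg (calling O _ a) (initList_stk _ _))).trans ?_
      have : Function.update (idle O) a (O a).tm.initialState = idle O :=
        Function.update_eq_self a (idle O)
      simp only [initList, Option.elim_some, this]
      rfl
    have e₂ : liftCfg O (Function.update S i []) none a (emb ∘ .inr) (emb (.inl false))
        (haltList (O a).tm (y.map (O a).outputAlphabet.invFun)) =
        ⟨some (emb (.inl false)), (none, idle O), calling O (Function.update S i []) a
          (Function.update (fun _ => []) (O a).tm.k₁ (y.map (O a).outputAlphabet.invFun))⟩ := by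
      refine (congrArg (TM2.Cfg.mk _ _) (congrArg (calling O _ a) (haltList_stk _ _))).trans ?_
      simp [haltList, idle]
    rw [e₁, e₂] at h₂
    have h₀ : Function.update (fun _ => []) (O a).tm.k₀ [] =
        fun k => ([] : List ((O a).tm.Γ k)) := Function.update_eq_self _ _
    rw [h₀, calling_nil] at h₁
    exact ⟨none, ((h₁.trans h₂).trans h₃).mono (by omega)⟩

variable (O) in
/-- The machine that runs the program `c`, with input register `i` and output register `j`. -/
noncomputable def machine [Fintype ι] [Fintype q] (c : Cmd ι q) (i j : ι) : Machine where
  tm :=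
    { K := Stacks ι O
      kDecidableEq := inferInstance
      kFin := haveI : ∀ a, Fintype (O a).tm.K := fun a => (O a).tm.kFin; inferInstance
      k₀ := .inl i
      k₁ := .inl j
      Γ := Alph O
      Λ := Option (Label O c)
      main := entry O c some none
      ΛFin := haveI := Label.finite O c; Fintype.ofFinite _
      σ := Ctl O
      initialState := (none, idle O)
      σFin := haveI : ∀ a, Fintype (O a).tm.σ := fun a => (O a).tm.σFin; inferInstance
      Γk₀Fin := inferInstanceAs (Fintype Sym)
      m := fun
        -- A final configuration must have the initial internal state, so the symbol last read is
        -- erased; this is the additional step in `Exec.outputs`.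
        | none => .load (fun _ => (none, idle O)) .halt
        | some l => compile O c some none l }
  inputAlphabet := Equiv.refl _
  outputAlphabet := Equiv.refl _

/-- A program that turns input `x` into output `y` yields a machine that does so. -/
theorem Exec.outputs [Fintype ι] [Fintype q] {c : Cmd ι q} {i j : ι} {x y : List Sym} {t : ℕ}
    (h : Exec O c (Function.update (fun _ => []) i x) (Function.update (fun _ => []) j y) t) :
    Outputs (machine O c i j) x y (t + 1) := by
  obtain ⟨r, h⟩ := reachesIn_compile h (machine O c i j).tm.m some none (fun _ => rfl) none
  have e : ∀ (k : ι) (z : List Sym),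
      (Function.update (fun _ => []) (.inl k) z : ∀ k : Stacks ι O, List (Alph O k)) =
        regs O (Function.update (fun _ => []) k z) := by
    intro k z
    rw [← update_regs]
    congr 1
    funext k
    cases k <;> rfl
  have e₀ : initList (machine O c i j).tm (x.map (machine O c i j).inputAlphabet.invFun) =
      ⟨some (entry O c some none), (none, idle O), regs O (Function.update (fun _ => []) i x)⟩ := by
    rw [← e]
    have := initList_stk (machine O c i j).tm (x.map (machine O c i j).inputAlphabet.invFun)
    rw [show x.map (machine O c i j).inputAlphabet.invFun = x from List.map_id x] at this ⊢
    exact congrArg (TM2.Cfg.mk _ _) this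
  have e₁ : haltList (machine O c i j).tm (y.map (machine O c i j).outputAlphabet.invFun) =
      ⟨none, (none, idle O), regs O (Function.update (fun _ => []) j y)⟩ := by
    rw [← e]
    have := haltList_stk (machine O c i j).tm (y.map (machine O c i j).outputAlphabet.invFun)
    rw [show y.map (machine O c i j).outputAlphabet.invFun = y from List.map_id y] at this ⊢
    exact congrArg (TM2.Cfg.mk _ _) this
  rw [Outputs, e₀, e₁]
  exact h.trans (ReachesIn.single rfl)

end Compile
end Language
end LogicalInduction

/-! ### Part: programs that assemble strings from parts. -/

namespace LogicalInduction
open Turing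

/-! ### Building strings -/

/-- Registers; `u` and `v` serve as scratch space. -/
inductive Reg : Type
  | inp | out | acc | aux | ext | buf | idx | expr | u | v
  deriving DecidableEq

instance : Fintype Reg where
  elems := {.inp, .out, .acc, .aux, .ext, .buf, .idx, .expr, .u, .v}
  complete := by intro r; cases r <;> decide

abbrev Store : Type := Reg → List Sym

variable {q : Type} {O : q → Machine}

theorem Exec.mono {c : Cmd Reg q} {S S' : Store} {s t : ℕ} (h : Exec O c S S' s) (hst : s ≤ t) :
    Exec O c S S' t := by
  cases h with
  | skip => exact .skip _ _
  | push i a _ _ h => exact .push _ _ _ _ (h.trans hst)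
  | seq h₁ h₂ h => exact .seq h₁ h₂ (h.trans hst)
  | pop h₁ h => exact .pop h₁ (h.trans hst)
  | loop_nil h₁ h => exact .loop_nil h₁ (h.trans hst)
  | loop_cons h h₁ h₂ h₃ => exact .loop_cons h h₁ h₂ (h₃.trans hst)
  | call h₁ h₂ h => exact .call h₁ h₂ (h.trans hst)

theorem Exec.of_eq {c : Cmd Reg q} {S S' S'' : Store} {s t : ℕ} (h : Exec O c S S' s)
    (hS : S' = S'') (hst : s ≤ t) : Exec O c S S'' t :=
  hS ▸ h.mono hst

theorem Exec.of_eq_left {c : Cmd Reg q} {S S' T : Store} {t : ℕ} (h : Exec O c S S' t)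
    (hS : S = T) : Exec O c T S' t :=
  hS ▸ h

/-- A loop that consumes register `i`, keeping an invariant. -/
theorem exec_loop {σ : Type*} {i : Reg} {f : Sym → Cmd Reg q} (st : List Sym → σ → Store)
    (step : Sym → σ → σ) (Inv : List Sym → σ → Prop) (t : ℕ) (hi : ∀ l s, st l s i = l)
    (hst : ∀ a l s, Function.update (st (a :: l) s) i l = st l s)
    (hf : ∀ a l s, Inv (a :: l) s →
      Exec O (f a) (st l s) (st l (step a s)) t ∧ Inv l (step a s)) :
    ∀ l s, Inv l s →
      Exec O (.loop i f) (st l s) (st [] (l.foldl (fun s a => step a s) s))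
        (l.length * (t + 1) + 1) := by
  intro l
  induction l with
  | nil => exact fun s _ => .loop_nil (hi _ _) (by simp)
  | cons a l ih =>
    intro s hs
    refine .loop_cons (hi _ _) ?_ (ih (step a s) (hf a l s hs).2) (r := t) ?_
    · rw [hst]; exact (hf a l s hs).1
    · simp only [List.length_cons]; ring_nf; omega

/-- Empties register `i`. -/
def clear (i : Reg) : Cmd Reg q := .loop i fun _ => .skip

theorem exec_clear (i : Reg) (S : Store) :
    Exec O (clear i) S (Function.update S i []) ((S i).length + 1) := by
  have h := exec_loop (O := O) (i := i) (f := fun _ => .skip)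
    (fun l (_ : Unit) => Function.update S i l) (fun _ s => s) (fun _ _ => True) 0
    (by simp) (by simp) (fun a l s _ => ⟨.skip _ _, trivial⟩) (S i) () trivial
  simp only [Function.update_eq_self] at h
  exact h.mono (by simp)

/-- Moves the contents of register `i` in front of register `j`, in reversed order. -/
def move (i j : Reg) : Cmd Reg q := .loop i fun a => .push j a

theorem exec_move {i j : Reg} (hij : i ≠ j) (S : Store) :
    Exec O (move i j) S (Function.update (Function.update S i []) j ((S i).reverse ++ S j))
      (2 * (S i).length + 1) := by
  have h := exec_loop (O := O) (i := i) (f := fun a => .push j a)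
    (fun l s => Function.update (Function.update S i l) j s) (fun a s => a :: s)
    (fun _ _ => True) 1 (fun l s => by simp [hij])
    (fun a l s => by rw [Function.update_comm hij.symm]; simp)
    (fun a l s _ => ⟨(Exec.push _ _ _ _ le_rfl).of_eq (by simp) le_rfl, trivial⟩) (S i) (S j)
    trivial
  simp only [Function.update_eq_self] at h
  refine h.of_eq ?_ (by omega)
  congr 1
  rw [List.foldl_flip_cons_eq_append']

/-- Puts a copy of register `i` in front of register `j`. -/
def copy (i j : Reg) : Cmd Reg q :=
  .seq (move i .u) (.loop .u fun a => .seq (.push i a) (.push j a))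

theorem exec_copy {i j : Reg} (hij : i ≠ j) (hi : i ≠ .u) (hj : j ≠ .u) (S : Store)
    (hS : S .u = []) :
    Exec O (copy i j) S (Function.update S j (S i ++ S j)) (5 * (S i).length + 2) := by
  have h := exec_loop (O := O) (i := .u) (f := fun a => .seq (.push i a) (.push j a))
    (fun l (s : List Sym) => Function.update (Function.update (Function.update S .u l) i s) j
      (s ++ S j)) (fun a s => a :: s) (fun _ _ => True) 2 (fun l s => by simp [hi.symm, hj.symm])
    (fun a l s => by
      rw [Function.update_comm hj, Function.update_comm hi]; simp)
    (fun a l s _ => ⟨(Exec.seq (.push _ _ _ _ le_rfl) (.push _ _ _ _ le_rfl) le_rfl).of_eq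
      (by funext k; simp only [Function.update_apply]; grind) le_rfl, trivial⟩) (S i).reverse []
    trivial
  have e : Function.update (Function.update S i []) .u ((S i).reverse ++ S .u) =
      Function.update (Function.update (Function.update S .u (S i).reverse) i []) j
        ([] ++ S j) := by
    funext k; simp only [Function.update_apply]; grind
  have h₁ := exec_move (O := O) hi S
  rw [e] at h₁
  refine (Exec.seq h₁ h le_rfl).of_eq ?_ (by simp only [List.length_reverse]; omega)
  rw [List.foldl_flip_cons_eq_append']
  funext k; simp only [Function.update_apply, List.reverse_reverse]; grind

/-- A part of a string: a fixed string, a register, or the output of a machine on a register. -/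
inductive Piece (q : Type) : Type
  | lit (l : List Sym)
  | reg (i : Reg)
  | call (a : q) (i : Reg)

/-- Puts a part in front of register `r`. -/
def Piece.cmd (r : Reg) : Piece q → Cmd Reg q
  | .lit l => l.foldr (fun a c => .seq c (.push r a)) .skip
  | .reg i => copy i r
  | .call a i => .seq (copy i .v) (.seq (move .v .u) (.seq (.call a .u .v) (move .v r)))

/-- The string denoted by a part. -/
def Piece.eval (F : q → List Sym → List Sym) (S : Store) : Piece q → List Sym
  | .lit l => l
  | .reg i => S i
  | .call a i => F a (S i)

/-- The part does not depend on register `r`, and all quantities involved are at most `B`. -/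
def Piece.Ok (O : q → Machine) (F : q → List Sym → List Sym) (S : Store) (r : Reg) (B : ℕ) :
    Piece q → Prop
  | .lit l => l.length ≤ B
  | .reg i => i ≠ r ∧ i ≠ .u ∧ i ≠ .v ∧ (S i).length ≤ B
  | .call a i => i ≠ r ∧ i ≠ .u ∧ i ≠ .v ∧ (S i).length ≤ B ∧
      Outputs (O a) (S i) (F a (S i)) B ∧ (F a (S i)).length ≤ B

/-- A call takes its argument reversed and returns its result reversed. So the argument is copied to
`.v` and reversed into `.u`, and the result is reversed on its way from `.v` to `r`; both scratch
registers end empty. -/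
theorem exec_piece {F : q → List Sym → List Sym} {S : Store} {r : Reg} {B : ℕ} (hu : S .u = [])
    (hv : S .v = []) (hru : r ≠ .u) (hrv : r ≠ .v) {p : Piece q} (hp : p.Ok O F S r B) :
    Exec O (p.cmd r) S (Function.update S r (p.eval F S ++ S r)) (12 * B + 6) := by
  cases p with
  | lit l =>
    have : ∀ l : List Sym, Exec O (Piece.cmd r (.lit l : Piece q)) S
        (Function.update S r (l ++ S r)) l.length := by
      intro l
      induction l with
      | nil => exact (Exec.skip S _).of_eq (by simp) le_rfl
      | cons a l ih =>
        exact (Exec.seq ih (.push _ _ _ _ le_rfl) le_rfl).of_eq (by simp) le_rfl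
    have hp : l.length ≤ B := hp
    exact (this l).mono (by omega)
  | reg i =>
    obtain ⟨h₁, h₂, h₃, h₄⟩ := hp
    exact (exec_copy h₁ h₂ hru S hu).mono (by omega)
  | call a i =>
    obtain ⟨h₁, h₂, h₃, h₄, h₅, h₆⟩ := hp
    have e₁ := exec_copy (O := O) (i := i) (j := .v) h₃ h₂ (by simp) S hu
    have e₂ := exec_move (O := O) (i := .v) (j := .u) (by simp)
      (Function.update S .v (S i ++ S .v))
    have e₃ : Exec O (.call a .u .v) (Function.update S .u (S i).reverse)
      (Function.update S .v (F a (S i)).reverse) (3 * B + 2) :=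
      (Exec.call (x := S i) (by simp) h₅ le_rfl).of_eq
        (by funext k; simp only [Function.update_apply]; grind) (by omega)
    have e₄ := exec_move (O := O) (i := .v) (j := r) hrv.symm
      (Function.update S .v (F a (S i)).reverse)
    simp only [hv, List.append_nil, Function.update_self, List.length_reverse,
      List.reverse_reverse] at e₁ e₂ e₄
    refine .seq e₁ (.seq (e₂.of_eq ?_ le_rfl) (.seq e₃ (e₄.of_eq ?_ le_rfl) le_rfl) le_rfl) ?_
    · funext k; simp only [Function.update_apply]; grind
    · funext k; simp only [Function.update_apply, Piece.eval]; grind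
    · omega

/-- Puts a string, given by its parts, in front of register `r`. -/
def emit (r : Reg) (ps : List (Piece q)) : Cmd Reg q :=
  ps.foldr (fun p c => .seq c (p.cmd r)) .skip

theorem Piece.eval_update {F : q → List Sym → List Sym} {S : Store} {r : Reg} {B : ℕ}
    {p : Piece q} (hp : p.Ok O F S r B) (l : List Sym) :
    p.eval F (Function.update S r l) = p.eval F S := by
  cases p with
  | lit => rfl
  | reg i => simp [eval, hp.1]
  | call a i => simp [eval, hp.1]

theorem Piece.Ok.update {F : q → List Sym → List Sym} {S : Store} {r : Reg} {B : ℕ}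
    {p : Piece q} (hp : p.Ok O F S r B) (l : List Sym) :
    p.Ok O F (Function.update S r l) r B := by
  cases p with
  | lit => exact hp
  | reg i => simpa [Ok, hp.1] using hp
  | call a i => simpa [Ok, hp.1] using hp

theorem exec_emit (F : q → List Sym → List Sym) {S : Store} {r : Reg} (B : ℕ)
    (hu : S .u = []) (hv : S .v = []) (hru : r ≠ .u) (hrv : r ≠ .v) {ps : List (Piece q)}
    (hps : ∀ p ∈ ps, p.Ok O F S r B) :
    Exec O (emit r ps) S (Function.update S r ((ps.map (Piece.eval F S)).flatten ++ S r))
      (ps.length * (12 * B + 6)) := by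
  induction ps with
  | nil => exact (Exec.skip S _).of_eq (by simp) le_rfl
  | cons p ps ih =>
    have hp := hps p (by simp)
    refine (Exec.seq (ih fun p hp => hps p (by simp [hp]))
      (exec_piece (by simp [hru.symm, hu]) (by simp [hrv.symm, hv]) hru hrv
        (hp.update _)) le_rfl).of_eq ?_ ?_
    · rw [Piece.eval_update hp]; simp
    · simp only [List.length_cons]; ring_nf; omega

end LogicalInduction

/-! ### Part: polynomial time with respect to a size function, and its closure properties. -/

namespace LogicalInduction
open Turing

/-! ### Functions computable within a polynomial of a given size -/

/-- A machine computes `f a` from the string `ea a` in time polynomial in `s a`. -/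
def ComputableIn {α : Type} (s : α → ℕ) (ea f : α → List Sym) : Prop :=
  ∃ (M : Machine) (p : Polynomial ℕ), ∀ a, Outputs M (ea a) (f a) (p.eval (s a))

theorem Outputs.mono {M : Machine} {x y : List Sym} {s t : ℕ} (h : Outputs M x y s)
    (hst : s ≤ t) : Outputs M x y t :=
  ReachesIn.mono h hst

theorem polynomial_eval_mono (p : Polynomial ℕ) {m n : ℕ} (h : m ≤ n) : p.eval m ≤ p.eval n := by
  rw [Polynomial.eval_eq_sum_range, Polynomial.eval_eq_sum_range]
  gcongr

theorem ComputableIn.mono {α : Type} {s s' : α → ℕ} {ea f : α → List Sym}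
    (h : ComputableIn s ea f) (hs : ∀ a, s a ≤ s' a) : ComputableIn s' ea f := by
  obtain ⟨M, p, h⟩ := h
  exact ⟨M, p, fun a => (h a).mono (polynomial_eval_mono p (hs a))⟩

theorem computableIn_iff_effComputable {β : Type} (e : β → List Sym) (x : ℕ → β) :
    ComputableIn (fun n => n) encUnary (fun n => e (x n)) ↔ EffComputable e x := by
  constructor
  · rintro ⟨M, p, h⟩
    choose n hn h using h
    exact ⟨{ M with
      time := p
      outputsFun := fun a => ⟨⟨n a, h a⟩, by simpa [encUnary] using hn a⟩ }⟩
  · rintro ⟨M⟩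
    refine ⟨M.toTM2ComputableAux, M.time, fun a => ?_⟩
    have := M.outputsFun a
    exact ⟨this.steps, by simpa [encUnary] using this.steps_le_m, this.evals_in_steps⟩

/-- Taking the running time itself as the size makes mere computability a case of `ComputableIn`, so
the closure properties serve both notions. -/
theorem TMComputable.computableIn {α β : Type} {ea : α → List Sym} {eb : β → List Sym}
    {f : α → β} (h : TMComputable ea eb f) : ∃ s, ComputableIn s ea (fun a => eb (f a)) := by
  obtain ⟨M⟩ := h
  exact ⟨fun a => (M.outputsFun a).steps, M.toTM2ComputableAux, Polynomial.X, fun a =>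
    ⟨_, by simp, (M.outputsFun a).evals_in_steps⟩⟩

theorem ComputableIn.tmComputable {α β : Type} {s : α → ℕ} {ea : α → List Sym}
    {eb : β → List Sym} {f : α → β} (h : ComputableIn s ea (fun a => eb (f a))) :
    TMComputable ea eb f := by
  obtain ⟨M, p, h⟩ := h
  choose n _ h using h
  exact ⟨{ M with outputsFun := fun a => ⟨n a, h a⟩ }⟩

/-! ### The length of the output -/

/-- A bound on the number of symbols that a statement pushes. -/
def pushes {K : Type} {Γ : K → Type} {Λ σ : Type} : TM2.Stmt Γ Λ σ → ℕ
  | .push _ _ s => pushes s + 1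
  | .peek _ _ s => pushes s
  | .pop _ _ s => pushes s
  | .load _ s => pushes s
  | .branch _ s t => pushes s + pushes t
  | .goto _ => 0
  | .halt => 0

theorem length_stepAux {K : Type} [DecidableEq K] {Γ : K → Type} {Λ σ : Type}
    (s : TM2.Stmt Γ Λ σ) (k : K) : ∀ (v : σ) (S : ∀ k, List (Γ k)),
      ((TM2.stepAux s v S).stk k).length ≤ (S k).length + pushes s := by
  induction s with
  | push j f s ih =>
    intro v S
    refine (ih v _).trans ?_
    by_cases h : k = j
    · subst h; simp [pushes]; omega
    · simp [h, pushes]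
  | peek j f s ih => exact fun v S => ih _ S
  | pop j f s ih =>
    intro v S
    refine (ih _ _).trans ?_
    by_cases h : k = j
    · subst h; simp [pushes]
    · simp [h, pushes]
  | load f s ih => exact fun v S => ih _ S
  | branch f s t ihs iht =>
    intro v S
    have h₁ := ihs v S
    have h₂ := iht v S
    simp only [TM2.stepAux, pushes]
    cases f v <;> simp only [cond] <;> omega
  | goto l => exact fun v S => le_rfl
  | halt => exact fun v S => le_rfl

/-- A step pushes at most as many symbols as all statements of the machine together, so time bounds
the length of the output. Programs that process the output of a call need this for their own time
bounds. -/
theorem Outputs.exists_length_le (M : Machine) :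
    ∃ C : ℕ, ∀ x y t, Outputs M x y t → y.length ≤ x.length + t * C := by
  have := M.tm.ΛFin
  refine ⟨∑ l, pushes (M.tm.m l), fun x y t ⟨n, hn, h⟩ => ?_⟩
  have key : ∀ (n : ℕ) (c d : M.tm.Cfg), (flip bind M.tm.step)^[n] (some c) = some d →
      (d.stk M.tm.k₁).length ≤ (c.stk M.tm.k₁).length + n * ∑ l, pushes (M.tm.m l) := by
    intro n
    induction n with
    | zero =>
      intro c d h
      simp only [Function.iterate_zero, id, Option.some.injEq] at h
      simp [h]
    | succ n ih =>
      intro c d h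
      rw [Function.iterate_succ_apply'] at h
      rcases h' : (flip bind M.tm.step)^[n] (some c) with _ | c'
      · rw [h'] at h
        exact (Option.some_ne_none d h.symm).elim
      · rw [h'] at h
        have h₁ := ih c c' h'
        obtain ⟨l, v, S⟩ := c'
        cases l with
        | none => exact (Option.some_ne_none d h.symm).elim
        | some l =>
          have hd : TM2.stepAux (M.tm.m l) v S = d := Option.some.inj h
          have h₂ := length_stepAux (M.tm.m l) M.tm.k₁ v S
          have h₃ := Finset.single_le_sum (f := fun l => pushes (M.tm.m l))
            (fun _ _ => Nat.zero_le _) (Finset.mem_univ l)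
          rw [hd] at h₂
          simp only at h₁ h₃
          rw [add_one_mul]
          omega
  have h₁ := key n _ _ h
  rw [haltList_stk, Function.update_self, List.length_map, initList_stk] at h₁
  have h₂ : (Function.update (fun _ => []) M.tm.k₀ (x.map M.inputAlphabet.invFun)
      M.tm.k₁ : List (M.tm.Γ M.tm.k₁)).length ≤ x.length := by
    -- Input and output stack may coincide, and then the input counts towards the initial length.
    by_cases hk : M.tm.k₁ = M.tm.k₀
    · generalize hz : x.map M.inputAlphabet.invFun = z
      have : z.length = x.length := by rw [← hz, List.length_map]
      rw [← this]
      clear this hz h₁ h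
      have : ∀ (k : M.tm.K), k = M.tm.k₀ →
          (Function.update (fun _ => []) M.tm.k₀ z k : List (M.tm.Γ k)).length ≤ z.length := by
        rintro k rfl; simp
      exact this _ hk
    · simp [hk]
  have h₃ : n * ∑ l, pushes (M.tm.m l) ≤ t * ∑ l, pushes (M.tm.m l) := by gcongr
  omega

theorem ComputableIn.exists_bound {α : Type} {s : α → ℕ} {ea f : α → List Sym}
    (h : ComputableIn s ea f) (hs : ∀ a, (ea a).length ≤ s a) :
    ∃ (M : Machine) (p : Polynomial ℕ), ∀ a, Outputs M (ea a) (f a) (p.eval (s a)) ∧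
      (f a).length ≤ p.eval (s a) := by
  obtain ⟨M, p, h⟩ := h
  obtain ⟨C, hC⟩ := Outputs.exists_length_le M
  refine ⟨M, Polynomial.X + p * Polynomial.C (C + 1), fun a => ⟨(h a).mono ?_, ?_⟩⟩
  · simp only [Polynomial.eval_add, Polynomial.eval_X, Polynomial.eval_mul, Polynomial.eval_C]
    nlinarith
  · have h₁ := hC _ _ _ (h a)
    have h₂ := hs a
    simp only [Polynomial.eval_add, Polynomial.eval_X, Polynomial.eval_mul, Polynomial.eval_C]
    nlinarith

/-! ### Closure properties -/

/-- The registers when a program starts or ends. -/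
def single (r : Reg) (l : List Sym) : Store := Function.update (fun _ => []) r l

theorem computableIn_of_exec {α q : Type} [Fintype q] [DecidableEq q] (O : q → Machine)
    (c : Cmd Reg q) {s : α → ℕ} {ea f : α → List Sym} (p : Polynomial ℕ)
    (h : ∀ a, Exec O c (single .inp (ea a)) (single .out (f a)) (p.eval (s a))) :
    ComputableIn s ea f :=
  ⟨machine O c .inp .out, p + 1, fun a => by
    simpa only [Polynomial.eval_add, Polynomial.eval_one] using (h a).outputs⟩

theorem ComputableIn.append {s : ℕ → ℕ} {f g : ℕ → List Sym} (hs : ∀ n, n ≤ s n)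
    (hf : ComputableIn s encUnary f) (hg : ComputableIn s encUnary g) :
    ComputableIn s encUnary (fun n => f n ++ g n) := by
  obtain ⟨M, p, hf⟩ := hf.exists_bound (by simpa [encUnary] using hs)
  obtain ⟨N, r, hg⟩ := hg.exists_bound (by simpa [encUnary] using hs)
  have key : ∀ n, Exec (fun b : Bool => if b then M else N)
      (.seq (emit .out [.call true .inp, .call false .inp]) (clear .inp))
      (single .inp (encUnary n)) (single .out (f n ++ g n))
      (2 * (12 * (s n + p.eval (s n) + r.eval (s n)) + 6) + (s n + 1)) := by
    intro n
    have hn := hs n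
    have h₁ := exec_emit (O := fun b : Bool => if b then M else N) (S := single .inp (encUnary n))
      (r := .out) (fun b _ => if b then f n else g n)
      (s n + p.eval (s n) + r.eval (s n)) (by simp [single]) (by simp [single]) (by simp)
      (by simp) (ps := [.call true .inp, .call false .inp]) (by
        simp only [List.mem_cons, List.not_mem_nil, or_false, forall_eq_or_imp, forall_eq,
          Piece.Ok, single, Function.update_self, encUnary, List.length_replicate]
        refine ⟨⟨by simp, by simp, by simp, by omega, (hf n).1.mono (by omega), ?_⟩,
          by simp, by simp, by simp, by omega, (hg n).1.mono (by omega), ?_⟩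
        · have := (hf n).2; simp; omega
        · have := (hg n).2; simp; omega)
    refine (Exec.seq h₁ (exec_clear _ _) le_rfl).of_eq ?_ ?_
    · funext k; cases k <;> simp [single, Piece.eval]
    · simp [single, encUnary]; omega
  refine computableIn_of_exec (fun b : Bool => if b then M else N)
    (.seq (emit .out [.call true .inp, .call false .inp]) (clear .inp))
    (2 * (12 * (.X + p + r) + 6) + (.X + 1)) fun n => ?_
  refine (key n).mono (le_of_eq ?_)
  simp

theorem computableIn_const (s : ℕ → ℕ) (hs : ∀ n, n ≤ s n) (w : List Sym) :
    ComputableIn s encUnary (fun _ => w) := by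
  refine computableIn_of_exec (fun a : Empty => a.elim)
    (.seq (clear .inp) (emit .out [.lit w])) (.X + 1 + .C (12 * w.length + 6)) fun n => ?_
  have hn := hs n
  refine (Exec.seq (exec_clear _ _) (exec_emit (fun a => a.elim) w.length (by simp [single])
    (by simp [single]) (by simp) (by simp) (by simp [Piece.Ok])) le_rfl).of_eq ?_ ?_
  · funext k; cases k <;> simp [single, Piece.eval]
  · simp [single, encUnary]; omega

theorem computableIn_unary (s : ℕ → ℕ) (hs : ∀ n, n ≤ s n) :
    ComputableIn s encUnary encUnary := by
  refine computableIn_of_exec (fun a : Empty => a.elim)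
    (.seq (emit .out [.reg .inp]) (clear .inp)) (12 * .X + 6 + (.X + 1)) fun n => ?_
  have hn := hs n
  refine (Exec.seq (exec_emit (fun a => a.elim) (s n) (by simp [single])
    (by simp [single]) (by simp) (by simp) (by simpa [Piece.Ok, single, encUnary] using hn))
    (exec_clear _ _) le_rfl).of_eq ?_ ?_
  · funext k; cases k <;> simp [single, Piece.eval]
  · simp [single, encUnary]; omega

/-- The ticks that remain in the input after each removal are the argument of the next call. This
yields `f (n - 1), …, f 0`, and as each result goes in front of the previous ones, the order comes
out right. -/
theorem ComputableIn.flatMap_range {s : ℕ → ℕ} {f : ℕ → List Sym} (hs : ∀ n, n ≤ s n)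
    (hm : Monotone s) (hf : ComputableIn s encUnary f) :
    ComputableIn s encUnary (fun n => (List.range n).flatMap f) := by
  obtain ⟨M, p, hf⟩ := hf.exists_bound (by simpa [encUnary] using hs)
  have key : ∀ B n, (∀ k < n, s k + p.eval (s k) ≤ B) → ∀ l, Exec (fun _ : Unit => M)
      (.loop .inp fun _ => emit .out [.call () .inp])
      (Function.update (single .out l) .inp (encUnary n))
      (single .out ((List.range n).flatMap f ++ l)) (n * (12 * B + 7) + 1) := by
    intro B n
    induction n with
    | zero =>
      intro _ l
      exact (Exec.loop_nil (by simp [encUnary]) le_rfl).of_eq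
        (by funext k; cases k <;> simp [single, encUnary]) (by simp)
    | succ n ih =>
      intro hB l
      have hn := hB n (by omega)
      have hl := hs n
      have h₁ := exec_emit (O := fun _ : Unit => M)
        (S := Function.update (single .out l) .inp (encUnary n)) (r := .out) (fun _ _ => f n) B
        (by simp [single]) (by simp [single]) (by simp) (by simp) (ps := [.call () .inp])
        (by
          simp only [List.mem_cons, List.not_mem_nil, or_false, forall_eq, Piece.Ok, single,
            Function.update_self, encUnary, List.length_replicate]
          exact ⟨by simp, by simp, by simp, by omega, (hf n).1.mono (by omega),
            (hf n).2.trans (by omega)⟩)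
      refine .loop_cons (a := .tick) (l := encUnary n)
        (S₁ := Function.update (single .out (f n ++ l)) .inp (encUnary n))
        (by simp [encUnary, List.replicate_succ])
        ((h₁.of_eq ?_ le_rfl).of_eq_left ?_)
        ((ih (fun k hk => hB k (by omega)) (f n ++ l)).of_eq ?_ le_rfl) ?_
      · funext k; cases k <;> simp [single, Piece.eval]
      · funext k; cases k <;> simp [single]
      · rw [List.range_succ]; simp
      · simp; ring_nf; omega
  refine computableIn_of_exec (fun _ : Unit => M)
    (.loop .inp fun _ => emit .out [.call () .inp]) (.X * (12 * (.X + p) + 7) + 1) fun n => ?_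
  have hB : ∀ k < n, s k + p.eval (s k) ≤ s n + p.eval (s n) := fun k hk =>
    add_le_add (hm hk.le) (polynomial_eval_mono p (hm hk.le))
  have hn := hs n
  refine ((key _ n hB []).of_eq (by simp) ?_).of_eq_left ?_
  · simp; gcongr
  · funext k; cases k <;> simp [single]

end LogicalInduction

/-! ### Part: simulating a single trade made at conditional prices. -/

namespace LogicalInduction

variable {Atom : Type}

/-! ### Conditional prices as features -/

/-- The conditional price of `φ` given `χ` on day `i`; it is exact if the price of `χ` on that day
is `0` or at least `1 / c`. -/
def priceCond (c : ℕ) (χ φ : Sentence Atom) (i : ℕ) : FeatExpr Atom :=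
  .add (.const 1) (.mul (.const (-c)) (.mul
    (.max (.const 0) (.add (.price χ i) (.mul (.const (-1)) (.price (.and φ χ) i))))
    (.safeInv (.mul (.const c) (.price χ i)))))

/-- With p and r the prices of χ and φ∧χ: if cp ≥ 1, the factor c cancels and the feature is 1 -
max(0, p - r)/p, which is r/p for r < p and 1 otherwise. If p = 0, then max(0, p - r) vanishes
because r ≥ 0, and the value is 1, as the convention for conditioning on price 0 demands. -/
theorem eval_priceCond {c : ℕ} {χ φ : Sentence Atom} {i : ℕ} {V : ℕ → Valuation Atom}
    (env : List ℝ) (h : V i χ = 0 ∨ 1 ≤ c * V i χ) (h₀ : 0 ≤ V i (.and φ χ)) :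
    (priceCond c χ φ i).eval V env = (V i).cond χ φ := by
  simp only [priceCond, FeatExpr.eval, Valuation.cond]
  push_cast
  rcases h with h | h
  · rw [h, if_neg (not_lt.2 h₀), max_eq_left (by linarith)]
    simp
  · have hpos : 0 < V i χ := by
      by_contra hn
      have : (c : ℝ) * V i χ ≤ 0 := mul_nonpos_of_nonneg_of_nonpos c.cast_nonneg (not_lt.1 hn)
      linarith
    have hc : (c : ℝ) ≠ 0 := by rintro hc; rw [hc] at h; linarith
    rw [max_eq_right h]
    split_ifs with hlt
    · rw [max_eq_right (by linarith)]
      field_simp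
      ring
    · rw [max_eq_left (by linarith)]
      simp

/-- Replaces prices by conditional prices. -/
def FeatExpr.condition (c : ℕ) (χ : ℕ → Sentence Atom) : FeatExpr Atom → FeatExpr Atom
  | .price φ i => priceCond c (χ i) φ i
  | .const q => .const q
  | .var j => .var j
  | .add e f => .add (e.condition c χ) (f.condition c χ)
  | .mul e f => .mul (e.condition c χ) (f.condition c χ)
  | .max e f => .max (e.condition c χ) (f.condition c χ)
  | .safeInv e => .safeInv (e.condition c χ)

theorem FeatExpr.WellFormed.condition {c n k : ℕ} {χ : ℕ → Sentence Atom} {e : FeatExpr Atom}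
    (h : e.WellFormed n k) : (e.condition c χ).WellFormed n k := by
  induction e with
  | price φ i =>
    have : i ≤ n := h
    simp [FeatExpr.condition, priceCond, WellFormed, this]
  | const q => exact h
  | var j => exact h
  | add e f he hf => exact ⟨he h.1, hf h.2⟩
  | mul e f he hf => exact ⟨he h.1, hf h.2⟩
  | max e f he hf => exact ⟨he h.1, hf h.2⟩
  | safeInv e he => exact he h

theorem FeatExpr.eval_condition {c : ℕ} {χ : ℕ → Sentence Atom} {V : ℕ → Valuation Atom}
    (h : ∀ i, V i (χ i) = 0 ∨ 1 ≤ c * V i (χ i)) (h₀ : ∀ i φ, 0 ≤ V i φ) (env : List ℝ)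
    (e : FeatExpr Atom) :
    (e.condition c χ).eval V env = e.eval (fun n => (V n).cond (χ n)) env := by
  induction e with
  | price φ i => exact eval_priceCond env (h i) (h₀ i _)
  | const q => rfl
  | var j => rfl
  | add e f he hf => simp [FeatExpr.condition, eval, he, hf]
  | mul e f he hf => simp [FeatExpr.condition, eval, he, hf]
  | max e f he hf => simp [FeatExpr.condition, eval, he, hf]
  | safeInv e he => simp [FeatExpr.condition, eval, he]

/-! ### Trading at conditional prices -/

/-- The amount `ξ`, reduced if it is positive and `φ ∧ χ` is more expensive than `χ`. -/
def reducedAmount (K : ℚ) (χ φ : Sentence Atom) (n : ℕ) (ξ : FeatExpr Atom) : FeatExpr Atom :=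
  .mul ξ (.safeInv (.mul (.const K) (.mul ξ (.max (.const 0)
    (.add (.price (.and φ χ) n) (.mul (.const (-1)) (.price χ n)))))))

/-- Simulates the trade `t`, which is made at conditional prices: it is called off if `χ` is
false. -/
def condTrade (c : ℕ) (K : ℚ) (χ : ℕ → Sentence Atom) (n : ℕ)
    (t : Sentence Atom × FeatExpr Atom) : List (Sentence Atom × FeatExpr Atom) :=
  [(.and t.1 (χ n), reducedAmount K (χ n) t.1 n (t.2.condition c χ)),
    (χ n, .mul (.const (-1)) (.mul (priceCond c (χ n) t.1 n)
      (reducedAmount K (χ n) t.1 n (t.2.condition c χ))))]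

/-- Simulates on day `n` the strategy `T`, which trades at conditional prices. -/
def Strategy.condition (c : ℕ) (K : ℚ) (χ : ℕ → Sentence Atom) (n : ℕ) (T : Strategy Atom) :
    Strategy Atom where
  defs := T.defs.map (FeatExpr.condition c χ)
  trades := T.trades.flatMap (condTrade c K χ n)

theorem Strategy.WellFormed.condition {c n : ℕ} {K : ℚ} {χ : ℕ → Sentence Atom}
    {T : Strategy Atom} (h : T.WellFormed n) : (T.condition c K χ n).WellFormed n := by
  refine ⟨fun j hj => ?_, fun t ht => ?_⟩
  · simp only [Strategy.condition, List.getElem_map]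
    exact (h.1 j (by simpa [Strategy.condition] using hj)).condition
  · simp only [Strategy.condition, List.mem_flatMap, condTrade, List.mem_cons, List.not_mem_nil,
      or_false, List.length_map] at ht ⊢
    obtain ⟨s, hs, rfl | rfl⟩ := ht <;>
    simp [reducedAmount, priceCond, FeatExpr.WellFormed, (h.2 s hs).condition (c := c) (χ := χ)]

theorem Strategy.env_condition {c n : ℕ} {K : ℚ} {χ : ℕ → Sentence Atom}
    {V : ℕ → Valuation Atom} (h : ∀ i, V i (χ i) = 0 ∨ 1 ≤ c * V i (χ i))
    (h₀ : ∀ i φ, 0 ≤ V i φ) (T : Strategy Atom) :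
    (T.condition c K χ n).env V = T.env (fun n => (V n).cond (χ n)) := by
  simp only [Strategy.env, Strategy.condition, List.foldl_map, FeatExpr.eval_condition h h₀]

/-- Here `w`, `b`, `a` are the truth values of φ, χ, φ∧χ, and `p`, `r` are the prices of χ and φ∧χ.
For r < p the amount is not reduced and the two sides differ only by 1/K. For r ≥ p let d = r - p
and let m be the divisor of the amount; the imitation is worth b(ξ/m)(w - 1) - ξd/m. -/
theorem reduced_trade_ge {K ξ a b p r w : ℝ} (hK : 0 < K) (hr : 0 ≤ r)
    (ha : a = w * b) (hb : b = 0 ∨ b = 1) (hw : w ≤ 1) :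
    b * (ξ * (w - (if r < p then r / p else 1))) - 1 / K ≤
      ξ * (1 / max 1 (K * (ξ * max 0 (r + -1 * p)))) * (a - r) +
        -1 * ((if r < p then r / p else 1) *
          (ξ * (1 / max 1 (K * (ξ * max 0 (r + -1 * p)))))) * (b - p) := by
  have hK' : 0 < 1 / K := by positivity
  subst ha
  by_cases hlt : r < p
  · have hpos : 0 < p := hr.trans_lt hlt
    rw [if_pos hlt, max_eq_left (by linarith : r + -1 * p ≤ 0)]
    simp only [mul_zero, zero_le_one, sup_of_le_left, div_one, mul_one]
    have e : r / p * p = r := by field_simp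
    have : ξ * (w * b - r) + -1 * (r / p * ξ) * (b - p) =
        b * (ξ * (w - r / p)) + ξ * (r / p * p - r) := by ring
    rw [this, e]
    linarith
  · rw [if_neg hlt, max_eq_right (by linarith : 0 ≤ r + -1 * p)]
    set d := r + -1 * p with hd
    have hd0 : 0 ≤ d := by rw [hd]; linarith
    set m := max 1 (K * (ξ * d)) with hm
    have hm1 : 1 ≤ m := le_max_left _ _
    have e : ξ * (1 / m) * (w * b - r) + -1 * (1 * (ξ * (1 / m))) * (b - p) =
        b * (ξ / m * (w - 1)) - ξ * d / m := by
      rw [hd]; field_simp; ring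
    rw [e]
    -- A sale is not reduced and gains from d. A purchase loses ξd/m ≤ 1/K on the price difference,
    -- and its reduction does no harm because w - 1 ≤ 0.
    rcases le_or_gt ξ 0 with hξ | hξ
    · have : m = 1 := max_eq_left ((mul_nonpos_of_nonneg_of_nonpos hK.le
        (mul_nonpos_of_nonpos_of_nonneg hξ hd0)).trans zero_le_one)
      rw [this]
      have := mul_nonpos_of_nonpos_of_nonneg hξ hd0
      simp only [div_one]
      linarith
    · have h₁ : ξ * d / m ≤ 1 / K := by
        rw [div_le_div_iff₀ (by linarith) hK]
        have : K * (ξ * d) ≤ m := le_max_right _ _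
        linarith
      have h₂ : ξ / m ≤ ξ := div_le_self hξ.le hm1
      have h₃ : ξ * (w - 1) ≤ ξ / m * (w - 1) :=
        mul_le_mul_of_nonpos_right h₂ (by linarith)
      have hb0 : 0 ≤ b := by rcases hb with rfl | rfl <;> norm_num
      have := mul_le_mul_of_nonneg_left h₃ hb0
      linarith

theorem World.PropConsistent.toValuation_and {W : World Atom} (hW : W.PropConsistent)
    (φ ψ : Sentence Atom) :
    W.toValuation (.and φ ψ) = W.toValuation φ * W.toValuation ψ := by
  simp only [World.toValuation, hW.and]
  cases W φ <;> cases W ψ <;> simp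

theorem World.toValuation_eq (W : World Atom) (φ : Sentence Atom) :
    W.toValuation φ = 0 ∨ W.toValuation φ = 1 := by
  simp only [World.toValuation]
  cases W φ <;> simp

theorem Strategy.le_value_condition {c n : ℕ} {K : ℚ} {χ : ℕ → Sentence Atom}
    {V : ℕ → Valuation Atom} (h : ∀ i, V i (χ i) = 0 ∨ 1 ≤ c * V i (χ i))
    (h₀ : ∀ i φ, 0 ≤ V i φ) (hK : 0 < K) (T : Strategy Atom) {W : World Atom}
    (hW : W.PropConsistent) :
    W.toValuation (χ n) * T.value n (fun n => (V n).cond (χ n)) W.toValuation -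
        T.trades.length / K ≤ (T.condition c K χ n).value n V W.toValuation := by
  simp only [Strategy.value, Strategy.env_condition h h₀]
  generalize T.env (fun n => (V n).cond (χ n)) = env
  simp only [Strategy.condition]
  induction T.trades with
  | nil => simp
  | cons t l ih =>
    have := reduced_trade_ge (K := K) (p := V n (χ n)) (ξ := t.2.eval (fun n => (V n).cond (χ n)) env)
      (by exact_mod_cast hK) (h₀ n (.and t.1 (χ n))) (hW.toValuation_and t.1 (χ n))
      (W.toValuation_eq (χ n))
      (by rcases W.toValuation_eq t.1 with h | h <;> rw [h] <;> norm_num)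
    simp only [List.map_cons, List.sum_cons, List.flatMap_cons, List.map_append, List.sum_append,
      condTrade, List.map_nil, List.sum_nil, List.length_cons] at ih ⊢
    simp only [FeatExpr.eval, reducedAmount, eval_priceCond env (h n) (h₀ n _),
      FeatExpr.eval_condition h h₀] at ih ⊢
    simp only [Valuation.cond] at this ih ⊢
    push_cast at this ih ⊢
    rw [mul_add, add_div]
    linarith

end LogicalInduction

/-! ### Part: from exploiting the conditional market to exploiting the original one. -/

namespace LogicalInduction

variable {Atom : Type}

/-! ### Exploitation at conditional prices -/

section Exploit

variable {χ : ℕ → Sentence Atom} {D D' : ℕ → Finset (Sentence Atom)}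

theorem eq_true_of_le (hχ : ∀ W : World Atom, W.PropConsistent → ∀ n, W (χ (n + 1)) = true →
    W (χ n) = true) {W : World Atom} (hW : W.PropConsistent) {m n : ℕ} (hmn : m ≤ n)
    (h : W (χ n) = true) : W (χ m) = true := by
  induction n, hmn using Nat.le_induction with
  | base => exact h
  | succ n _ ih => exact ih (hχ W hW n h)

/-- All sentences added up to day `n` follow from the last one. -/
theorem mem_pcWorlds_iff (hχ : ∀ W : World Atom, W.PropConsistent → ∀ n, W (χ (n + 1)) = true →
    W (χ n) = true) (hD' : ∀ n φ, φ ∈ D' n ↔ φ ∈ D n ∨ ∃ i ≤ n, χ i = φ) {W : World Atom} {n : ℕ} :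
    W ∈ pcWorlds (D' n : Set (Sentence Atom)) ↔
      W ∈ pcWorlds (D n : Set (Sentence Atom)) ∧ W (χ n) = true := by
  constructor
  · rintro ⟨hW, h⟩
    exact ⟨⟨hW, fun φ hφ => h φ ((hD' n φ).2 (.inl hφ))⟩, h _ ((hD' n _).2 (.inr ⟨n, le_rfl, rfl⟩))⟩
  · rintro ⟨⟨hW, h⟩, hn⟩
    refine ⟨hW, fun φ hφ => ?_⟩
    rcases (hD' n φ).1 hφ with h' | ⟨i, hi, rfl⟩
    · exact h φ h'
    · exact eq_true_of_le hχ hW hi hn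

theorem pcWorlds_anti {A B : Set (Sentence Atom)} (h : A ⊆ B) : pcWorlds B ⊆ pcWorlds A :=
  fun _ hW => ⟨hW.1, fun φ hφ => hW.2 φ (h hφ)⟩

/-- The losses of the imitation add up to at most 2 by `hTK`. Where `χ n` is true, none of the
trades up to day `n` has been called off, so the worth of `T` is matched up to this 2 and the upper
side is unbounded. The lower bound must also cover worlds in which some `χ i` is false. -/
theorem Exploits.condition {P : ℕ → Valuation Atom} {T : ℕ → Strategy Atom} {c : ℕ} {K : ℕ → ℚ}
    (hχ : ∀ W : World Atom, W.PropConsistent → ∀ n, W (χ (n + 1)) = true → W (χ n) = true)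
    (hD : Monotone D) (hD' : ∀ n φ, φ ∈ D' n ↔ φ ∈ D n ∨ ∃ i ≤ n, χ i = φ)
    (h₀ : ∀ i φ, 0 ≤ P i φ) (hc : ∀ i, P i (χ i) = 0 ∨ 1 ≤ c * P i (χ i)) (hK : ∀ n, 0 < K n)
    (hTK : ∀ n, ((T n).trades.length : ℝ) / K n ≤ (1 / 2) ^ n)
    (hT : Exploits T (fun n => (P n).cond (χ n)) D') :
    Exploits (fun n => (T n).condition c (K n) χ n) P D := by
  set Q : ℕ → Valuation Atom := fun n => (P n).cond (χ n) with hQ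
  have hle : ∀ (W : World Atom), W.PropConsistent → ∀ n,
      ∑ i ∈ Finset.range (n + 1), W.toValuation (χ i) * (T i).value i Q W.toValuation - 2 ≤
        ∑ i ∈ Finset.range (n + 1),
          ((T i).condition c (K i) χ i).value i P W.toValuation := by
    intro W hW n
    have h₁ : ∑ i ∈ Finset.range (n + 1), (W.toValuation (χ i) *
        (T i).value i Q W.toValuation - (1 / 2 : ℝ) ^ i) ≤ ∑ i ∈ Finset.range (n + 1),
          ((T i).condition c (K i) χ i).value i P W.toValuation := by
      refine Finset.sum_le_sum fun i _ => ?_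
      have := (T i).le_value_condition (n := i) hc h₀ (hK i) hW
      linarith [hTK i]
    rw [Finset.sum_sub_distrib] at h₁
    linarith [sum_geometric_two_le (n + 1)]
  have htrue : ∀ (W : World Atom), W.PropConsistent → ∀ n, W (χ n) = true →
      ∑ i ∈ Finset.range (n + 1), W.toValuation (χ i) * (T i).value i Q W.toValuation =
        ∑ i ∈ Finset.range (n + 1), (T i).value i Q W.toValuation := by
    intro W hW n hn
    refine Finset.sum_congr rfl fun i hi => ?_
    have := eq_true_of_le hχ hW (Nat.lt_succ_iff.1 (Finset.mem_range.1 hi)) hn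
    simp [World.toValuation, this]
  obtain ⟨⟨L, hL⟩, hU⟩ := hT
  constructor
  · refine ⟨min L 0 - 2, ?_⟩
    rintro x ⟨n, W, hW, rfl⟩
    refine le_trans ?_ (hle W hW.1 n)
    gcongr
    -- Going back from day `n`, the days on which `χ` is false contribute 0. The search stops at a
    -- day on which `W` is plausible for `D'`, where the bound `L` applies, or it runs past day 0,
    -- where the worth is 0; hence `min L 0`.
    induction n with
    | zero =>
      by_cases h : W (χ 0) = true
      · rw [htrue W hW.1 0 h]
        exact (min_le_left _ _).trans (hL ⟨0, W, (mem_pcWorlds_iff hχ hD').2 ⟨hW, h⟩, rfl⟩)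
      · simp [World.toValuation, h]
    | succ n ih =>
      by_cases h : W (χ (n + 1)) = true
      · rw [htrue W hW.1 (n + 1) h]
        exact (min_le_left _ _).trans (hL ⟨n + 1, W, (mem_pcWorlds_iff hχ hD').2 ⟨hW, h⟩, rfl⟩)
      · rw [Finset.sum_range_succ]
        have : W.toValuation (χ (n + 1)) = 0 := by simp [World.toValuation, h]
        rw [this, zero_mul, add_zero]
        exact ih (pcWorlds_anti (by exact_mod_cast hD n.le_succ) hW)
  · rintro ⟨M, hM⟩
    refine hU ⟨M + 2, ?_⟩
    rintro x ⟨n, W, hW, rfl⟩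
    obtain ⟨hW, hn⟩ := (mem_pcWorlds_iff hχ hD').1 hW
    have h₁ := hM ⟨n, W, hW, rfl⟩
    have h₂ := hle W hW.1 n
    rw [htrue W hW.1 n hn] at h₂
    linarith

/-- If no world were plausible on day `n`, none would be on later days, and only finitely many days
would contribute plausible values. On each day the value is at most the sum of the absolute amounts
traded, because truth values and prices differ by at most 1. -/
theorem Exploits.exists_mem_pcWorlds {P : ℕ → Valuation Atom} {T : ℕ → Strategy Atom}
    (hP : ∀ n φ, 0 ≤ P n φ ∧ P n φ ≤ 1) (hD : Monotone D) (hT : Exploits T P D) (n : ℕ) :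
    ∃ W, W ∈ pcWorlds (D n : Set (Sentence Atom)) := by
  by_contra! hn
  apply hT.2
  have hb : ∀ i (W : World Atom), (T i).value i P W.toValuation ≤
      ((T i).trades.map fun t => |t.2.eval P ((T i).env P)|).sum := by
    intro i W
    refine List.sum_le_sum fun t _ => ?_
    refine (le_abs_self _).trans ?_
    rw [abs_mul]
    refine mul_le_of_le_one_right (abs_nonneg _) (abs_le.2 ?_)
    have := hP i t.1
    rcases W.toValuation_eq t.1 with h | h <;> rw [h] <;> constructor <;> linarith
  refine ⟨∑ i ∈ Finset.range n,
    ((T i).trades.map fun t => |t.2.eval P ((T i).env P)|).sum, ?_⟩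
  rintro x ⟨m, W, hW, rfl⟩
  have hmn : m < n := by
    by_contra! h
    exact hn W (pcWorlds_anti (by exact_mod_cast hD h) hW)
  refine (Finset.sum_le_sum fun i _ => hb i W).trans
    (Finset.sum_le_sum_of_subset_of_nonneg (by simpa using hmn) fun i _ _ => ?_)
  refine List.sum_nonneg fun x hx => ?_
  obtain ⟨t, -, rfl⟩ := List.mem_map.1 hx
  exact abs_nonneg _

end Exploit

/-! ### Buying a sequence of sentences cheaply -/

/-- The growth of the divisor of the price limit, for prices `p`. -/
noncomputable def limitInv (p : ℕ → ℝ) : ℕ → ℝ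
  | 0 => 1
  | n + 1 => limitInv p n * (1 + max 0 (1 + -1 * (p n * limitInv p n)))

/-- The number of shares bought on day `n`, for prices `p`. -/
noncomputable def shares (p : ℕ → ℝ) (n : ℕ) : ℝ := max 0 (1 + -1 * (p n * limitInv p n))

theorem shares_nonneg (p : ℕ → ℝ) (n : ℕ) : 0 ≤ shares p n := le_max_left _ _

theorem limitInv_succ (p : ℕ → ℝ) (n : ℕ) :
    limitInv p (n + 1) = limitInv p n * (1 + shares p n) := rfl

theorem one_le_limitInv (p : ℕ → ℝ) (n : ℕ) : 1 ≤ limitInv p n := by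
  induction n with
  | zero => exact le_rfl
  | succ n ih =>
    rw [limitInv_succ]
    nlinarith [shares_nonneg p n]

/-- Let L be the current divisor and x the number of shares. Something is bought only if pL < 1, so
the cost px is at most x/L. Since x ≤ 1, this is at most 2x/(L(1 + x)) = 2/L - 2/(L(1 + x)), and the
sum telescopes. -/
theorem sum_shares_mul_le {p : ℕ → ℝ} (hp : ∀ n, 0 ≤ p n) (n : ℕ) :
    ∑ i ∈ Finset.range n, shares p i * p i ≤ 2 - 2 / limitInv p n := by
  induction n with
  | zero => simp [limitInv]
  | succ n ih =>
    rw [Finset.sum_range_succ, limitInv_succ]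
    have hg := one_le_limitInv p n
    have hx := shares_nonneg p n
    have hx1 : shares p n ≤ 1 := by
      refine max_le zero_le_one ?_
      have : 0 ≤ p n * limitInv p n := mul_nonneg (hp n) (by linarith)
      linarith
    have hcost : shares p n * p n ≤ shares p n / limitInv p n := by
      rcases eq_or_lt_of_le hx with h | h
      · rw [← h]; simp
      · have : 0 < 1 + -1 * (p n * limitInv p n) := by
          by_contra! hle
          rw [shares, max_eq_left hle] at h
          exact lt_irrefl _ h
        rw [le_div_iff₀ (by linarith)]
        nlinarith
    have hstep : shares p n / limitInv p n ≤
        2 / limitInv p n - 2 / (limitInv p n * (1 + shares p n)) := by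
      have : 2 / limitInv p n - 2 / (limitInv p n * (1 + shares p n)) =
          2 * shares p n / (limitInv p n * (1 + shares p n)) := by
        have : limitInv p n ≠ 0 := by linarith
        have : 1 + shares p n ≠ 0 := by linarith
        field_simp; ring
      rw [this, div_le_div_iff₀ (by linarith) (by nlinarith)]
      nlinarith [mul_nonneg hx (by linarith : 0 ≤ limitInv p n)]
    linarith

theorem limitInv_le_exp (p : ℕ → ℝ) (n : ℕ) :
    limitInv p n ≤ Real.exp (∑ i ∈ Finset.range n, shares p i) := by
  induction n with
  | zero => simp [limitInv]
  | succ n ih =>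
    rw [limitInv_succ, Finset.sum_range_succ, Real.exp_add]
    have := Real.add_one_le_exp (shares p n)
    have := shares_nonneg p n
    have := one_le_limitInv p n
    exact mul_le_mul ih (by linarith) (by linarith) (Real.exp_nonneg _)

/-- If the sum converged, `limitInv` would stay below some G by `limitInv_le_exp`, and every price
below 1/(2G) would lead to a purchase of more than half a share. Positive prices that small occur
arbitrarily late, whereas the purchases would tend to 0. -/
theorem tendsto_sum_shares {p : ℕ → ℝ} (hp : ∀ n, 0 ≤ p n)
    (h : ∀ c : ℕ, ∃ n, p n ≠ 0 ∧ c * p n < 1) :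
    Filter.Tendsto (fun n => ∑ i ∈ Finset.range n, shares p i) Filter.atTop Filter.atTop := by
  rw [← not_summable_iff_tendsto_nat_atTop_of_nonneg (shares_nonneg p)]
  intro hs
  set G := Real.exp (∑' i, shares p i) with hG
  have hgG : ∀ n, limitInv p n ≤ G := fun n => (limitInv_le_exp p n).trans
    (Real.exp_le_exp.2 (hs.sum_le_tsum _ fun i _ => shares_nonneg p i))
  obtain ⟨N, hN⟩ := Filter.eventually_atTop.1
    (hs.tendsto_atTop_zero.eventually (gt_mem_nhds (by norm_num : (0 : ℝ) < 1 / 2)))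
  -- The sum excludes the days before `N`, so the day found for `c` is a late one. Days with price 0
  -- contribute `1 / 0 = 0`, which is harmless because the day found has a nonzero price.
  obtain ⟨c, hc⟩ := exists_nat_ge (2 * G + ∑ n ∈ Finset.range N, 1 / p n)
  obtain ⟨n, hn, hcn⟩ := h c
  have hpn : 0 < p n := lt_of_le_of_ne (hp n) hn.symm
  have hG0 : 0 < G := Real.exp_pos _
  have hsum : ∀ i ∈ Finset.range N, 0 ≤ 1 / p i := fun i _ => one_div_nonneg.2 (hp i)
  rcases lt_or_ge n N with hnN | hnN
  · have h₁ := Finset.single_le_sum hsum (Finset.mem_range.2 hnN)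
    have h₂ : 1 / p n ≤ c := by linarith
    rw [div_le_iff₀ hpn] at h₂
    linarith
  · have h₁ := hN n hnN
    have h₂ : 1 + -1 * (p n * limitInv p n) < 1 / 2 := (le_max_right _ _).trans_lt h₁
    have h₃ : p n * limitInv p n ≤ p n * G := mul_le_mul_of_nonneg_left (hgG n) hpn.le
    have h₄ : 2 * G ≤ c := by linarith [Finset.sum_nonneg hsum]
    nlinarith

/-- The number of shares bought on day `j`, as a feature; variable `j` is the inverse of the
price limit. -/
def sharesExpr (χ : ℕ → Sentence Atom) (j : ℕ) : FeatExpr Atom :=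
  .max (.const 0) (.add (.const 1) (.mul (.const (-1)) (.mul (.price (χ j) j) (.var j))))

/-- The strategy, for day `n`, of the trader that buys the sentences `χ` cheaply. -/
def buyer (χ : ℕ → Sentence Atom) (n : ℕ) : Strategy Atom where
  defs := .const 1 :: (List.range n).map fun j =>
    .mul (.var j) (.add (.const 1) (sharesExpr χ j))
  trades := [(χ n, sharesExpr χ n)]

theorem buyer_wellFormed (χ : ℕ → Sentence Atom) : IsTrader (buyer χ) := by
  refine fun n => ⟨fun j hj => ?_, fun t ht => ?_⟩
  · cases j with
    | zero => simp [buyer, FeatExpr.WellFormed]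
    | succ j =>
      simp only [buyer, List.length_cons, List.length_map, List.length_range] at hj
      simp only [buyer, List.getElem_cons_succ, List.getElem_map, List.getElem_range, sharesExpr,
        FeatExpr.WellFormed]
      simp
      omega
  · simp only [buyer, List.mem_cons, List.not_mem_nil, or_false] at ht
    subst ht
    simp [buyer, sharesExpr, FeatExpr.WellFormed]

theorem eval_sharesExpr {χ : ℕ → Sentence Atom} {V : ℕ → Valuation Atom} {n : ℕ} {env : List ℝ}
    (h : env.getD n 0 = limitInv (fun j => V j (χ j)) n) :
    (sharesExpr χ n).eval V env = shares (fun j => V j (χ j)) n := by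
  simp only [FeatExpr.eval, sharesExpr, h, shares]
  simp

/-- The strategy recomputes the history of the limit in its variables. The recursion mentions the
previous divisor twice, so without variables the expression would double in size with each day. -/
theorem buyer_env (χ : ℕ → Sentence Atom) (V : ℕ → Valuation Atom) (n : ℕ) :
    (buyer χ n).env V = (List.range (n + 1)).map (limitInv fun j => V j (χ j)) := by
  induction n with
  | zero => simp [Strategy.env, buyer, FeatExpr.eval, limitInv]
  | succ n ih =>
    rw [List.range_succ, List.map_append, ← ih]
    have : (List.map (limitInv fun j => V j (χ j)) (List.range (n + 1))).getD n 0 =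
        limitInv (fun j => V j (χ j)) n := by
      simp [List.getD_eq_getElem?_getD]
    rw [← ih] at this
    simp only [Strategy.env, buyer, List.foldl_cons, List.range_succ, List.map_append,
      List.foldl_append, List.map_cons, List.map_nil, List.foldl_nil] at this ⊢
    have h := eval_sharesExpr this
    simp only [FeatExpr.eval, h, this, limitInv_succ] at this h ⊢
    simp

theorem buyer_value (χ : ℕ → Sentence Atom) (V : ℕ → Valuation Atom) (n : ℕ)
    (U : Valuation Atom) :
    (buyer χ n).value n V U = shares (fun j => V j (χ j)) n * (U (χ n) - V n (χ n)) := by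
  have : (List.map (limitInv fun j => V j (χ j)) (List.range (n + 1))).getD n 0 =
      limitInv (fun j => V j (χ j)) n := by
    simp [List.getD_eq_getElem?_getD]
  rw [Strategy.value, buyer_env]
  simp [buyer, eval_sharesExpr this]

/-- The worth is the number of shares held of true sentences minus a cost of at most 2, so it never
falls below -2. In a world plausible for `D' n`, which is also plausible for `D n`, every sentence
bought so far is true, and the number of shares is unbounded. -/
theorem buyer_exploits {χ : ℕ → Sentence Atom} {P : ℕ → Valuation Atom}
    {D D' : ℕ → Finset (Sentence Atom)}
    (hD' : ∀ n φ, φ ∈ D' n ↔ φ ∈ D n ∨ ∃ i ≤ n, χ i = φ)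
    (h₀ : ∀ i φ, 0 ≤ P i φ) (hc : ∀ c : ℕ, ∃ n, P n (χ n) ≠ 0 ∧ c * P n (χ n) < 1)
    (hne : ∀ n, ∃ W, W ∈ pcWorlds (D' n : Set (Sentence Atom))) : Exploits (buyer χ) P D := by
  have hsum : ∀ n (W : World Atom),
      ∑ i ∈ Finset.range n, (buyer χ i).value i P W.toValuation =
        ∑ i ∈ Finset.range n, shares (fun j => P j (χ j)) i * W.toValuation (χ i) -
          ∑ i ∈ Finset.range n, shares (fun j => P j (χ j)) i * P i (χ i) := by
    intro n W
    rw [← Finset.sum_sub_distrib]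
    exact Finset.sum_congr rfl fun i _ => by rw [buyer_value, mul_sub]
  have hcost : ∀ n, ∑ i ∈ Finset.range n, shares (fun j => P j (χ j)) i * P i (χ i) ≤ 2 := by
    intro n
    have h₁ := sum_shares_mul_le (p := fun j => P j (χ j)) (fun j => h₀ j _) n
    have h₂ : 0 ≤ 2 / limitInv (fun j => P j (χ j)) n :=
      div_nonneg zero_le_two (zero_le_one.trans (one_le_limitInv _ n))
    linarith
  constructor
  · refine ⟨-2, ?_⟩
    rintro x ⟨n, W, -, rfl⟩
    rw [hsum]
    have : 0 ≤ ∑ i ∈ Finset.range (n + 1),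
        shares (fun j => P j (χ j)) i * W.toValuation (χ i) :=
      Finset.sum_nonneg fun i _ => mul_nonneg (shares_nonneg _ _)
        (by rcases W.toValuation_eq (χ i) with h | h <;> rw [h] <;> norm_num)
    linarith [hcost (n + 1)]
  · rintro ⟨M, hM⟩
    obtain ⟨n, hn⟩ := ((tendsto_sum_shares (p := fun j => P j (χ j)) (fun j => h₀ j _)
      hc).comp (Filter.tendsto_add_atTop_nat 1)).eventually_gt_atTop (M + 2) |>.exists
    obtain ⟨W, hW⟩ := hne n
    have h₁ := hM ⟨n, W, pcWorlds_anti (fun φ hφ => (hD' n φ).2 (.inl hφ)) hW, rfl⟩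
    rw [hsum] at h₁
    have h₂ : ∑ i ∈ Finset.range (n + 1), shares (fun j => P j (χ j)) i * W.toValuation (χ i) =
        ∑ i ∈ Finset.range (n + 1), shares (fun j => P j (χ j)) i := by
      refine Finset.sum_congr rfl fun i hi => ?_
      have : W (χ i) = true :=
        hW.2 _ ((hD' n _).2 (.inr ⟨i, Nat.lt_succ_iff.1 (Finset.mem_range.1 hi), rfl⟩))
      simp [World.toValuation, this]
    have h₃ : M + 2 < ∑ i ∈ Finset.range (n + 1), shares (fun j => P j (χ j)) i := hn
    linarith [hcost (n + 1)]

end LogicalInduction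

/-! ### Part: computability of the conditional market. -/

namespace LogicalInduction

/-! ### Stores with named contents -/

/-- The store with the given contents and empty scratch registers. -/
def store (inp out acc aux ext buf idx expr : List Sym) : Store
  | .inp => inp
  | .out => out
  | .acc => acc
  | .aux => aux
  | .ext => ext
  | .buf => buf
  | .idx => idx
  | .expr => expr
  | .u => []
  | .v => []

section

variable (inp out acc aux ext buf idx expr l : List Sym)

@[simp] theorem store_inp : store inp out acc aux ext buf idx expr .inp = inp := rfl
@[simp] theorem store_out : store inp out acc aux ext buf idx expr .out = out := rfl
@[simp] theorem store_acc : store inp out acc aux ext buf idx expr .acc = acc := rfl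
@[simp] theorem store_aux : store inp out acc aux ext buf idx expr .aux = aux := rfl
@[simp] theorem store_ext : store inp out acc aux ext buf idx expr .ext = ext := rfl
@[simp] theorem store_buf : store inp out acc aux ext buf idx expr .buf = buf := rfl
@[simp] theorem store_idx : store inp out acc aux ext buf idx expr .idx = idx := rfl
@[simp] theorem store_expr : store inp out acc aux ext buf idx expr .expr = expr := rfl
@[simp] theorem store_u : store inp out acc aux ext buf idx expr .u = [] := rfl
@[simp] theorem store_v : store inp out acc aux ext buf idx expr .v = [] := rfl

@[simp] theorem update_store_inp : Function.update (store inp out acc aux ext buf idx expr) .inp l =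
    store l out acc aux ext buf idx expr := by funext k; cases k <;> rfl
@[simp] theorem update_store_out : Function.update (store inp out acc aux ext buf idx expr) .out l =
    store inp l acc aux ext buf idx expr := by funext k; cases k <;> rfl
@[simp] theorem update_store_acc : Function.update (store inp out acc aux ext buf idx expr) .acc l =
    store inp out l aux ext buf idx expr := by funext k; cases k <;> rfl
@[simp] theorem update_store_aux : Function.update (store inp out acc aux ext buf idx expr) .aux l =
    store inp out acc l ext buf idx expr := by funext k; cases k <;> rfl
@[simp] theorem update_store_ext : Function.update (store inp out acc aux ext buf idx expr) .ext l =
    store inp out acc aux l buf idx expr := by funext k; cases k <;> rfl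
@[simp] theorem update_store_buf : Function.update (store inp out acc aux ext buf idx expr) .buf l =
    store inp out acc aux ext l idx expr := by funext k; cases k <;> rfl
@[simp] theorem update_store_idx : Function.update (store inp out acc aux ext buf idx expr) .idx l =
    store inp out acc aux ext buf l expr := by funext k; cases k <;> rfl
@[simp] theorem update_store_expr :
    Function.update (store inp out acc aux ext buf idx expr) .expr l =
      store inp out acc aux ext buf idx l := by funext k; cases k <;> rfl

theorem single_inp : single .inp l = store l [] [] [] [] [] [] [] := by
  funext k; cases k <;> rfl

theorem single_out : single .out l = store [] l [] [] [] [] [] [] := by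
  funext k; cases k <;> rfl

end

/-! ### Termination without a time bound -/

variable {q : Type}

/-- The program `c` turns the registers `S` into `S'`. -/
def Runs (O : q → Machine) (c : Cmd Reg q) (S S' : Store) : Prop := ∃ t, Exec O c S S' t

variable {O : q → Machine}

theorem Runs.seq {c d : Cmd Reg q} {S S₁ S₂ : Store} (h₁ : Runs O c S S₁) (h₂ : Runs O d S₁ S₂) :
    Runs O (.seq c d) S S₂ := by
  obtain ⟨s, h₁⟩ := h₁
  obtain ⟨t, h₂⟩ := h₂
  exact ⟨_, .seq h₁ h₂ le_rfl⟩

theorem Runs.pop {i : Reg} {f : Option Sym → Cmd Reg q} {S S' : Store}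
    (h : Runs O (f (S i).head?) (Function.update S i (S i).tail) S') : Runs O (.pop i f) S S' := by
  obtain ⟨t, h⟩ := h
  exact ⟨_, .pop h le_rfl⟩

theorem Runs.skip (S : Store) : Runs O .skip S S := ⟨0, .skip _ _⟩

theorem Runs.push {i : Reg} {a : Sym} {S S' : Store}
    (h : S' = Function.update S i (a :: S i)) : Runs O (.push i a) S S' :=
  h ▸ ⟨1, .push _ _ _ _ le_rfl⟩

theorem Runs.clear {i : Reg} {S S' : Store} (h : S' = Function.update S i []) :
    Runs O (clear i) S S' :=
  h ▸ ⟨_, exec_clear i S⟩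

theorem Runs.move {i j : Reg} {S S' : Store} (hij : i ≠ j)
    (h : S' = Function.update (Function.update S i []) j ((S i).reverse ++ S j)) :
    Runs O (move i j) S S' :=
  h ▸ ⟨_, exec_move hij S⟩

theorem Runs.loop {σ : Type*} {i : Reg} {f : Sym → Cmd Reg q} (st : List Sym → σ → Store)
    (step : Sym → σ → σ) (hi : ∀ l s, st l s i = l)
    (hst : ∀ a l s, Function.update (st (a :: l) s) i l = st l s) :
    ∀ l s, (∀ a ∈ l, ∀ l s, Runs O (f a) (st l s) (st l (step a s))) →
      Runs O (.loop i f) (st l s) (st [] (l.foldl (fun s a => step a s) s)) := by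
  intro l
  induction l with
  | nil => exact fun s _ => ⟨1, .loop_nil (hi _ _) le_rfl⟩
  | cons a l ih =>
    intro s hf
    obtain ⟨t, h₁⟩ := hf a (by simp) l s
    obtain ⟨r, h₂⟩ := ih (step a s) fun b hb => hf b (by simp [hb])
    exact ⟨_, .loop_cons (hi _ _) (by rw [hst]; exact h₁) h₂ le_rfl⟩

theorem Piece.Ok.mono {F : q → List Sym → List Sym} {S : Store} {r : Reg} {B C : ℕ}
    {p : Piece q} (hp : p.Ok O F S r B) (h : B ≤ C) : p.Ok O F S r C := by
  cases p with
  | lit l => exact le_trans hp h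
  | reg i => exact ⟨hp.1, hp.2.1, hp.2.2.1, hp.2.2.2.trans h⟩
  | call a i =>
    obtain ⟨h₁, h₂, h₃, h₄, h₅, h₆⟩ := hp
    exact ⟨h₁, h₂, h₃, h₄.trans h, h₅.mono h, h₆.trans h⟩

/-- The part does not depend on register `r`, and the machine called halts. -/
def Piece.Fine (O : q → Machine) (F : q → List Sym → List Sym) (S : Store) (r : Reg) :
    Piece q → Prop
  | .lit _ => True
  | .reg i => i ≠ r ∧ i ≠ .u ∧ i ≠ .v
  | .call a i => i ≠ r ∧ i ≠ .u ∧ i ≠ .v ∧ ∃ t, Outputs (O a) (S i) (F a (S i)) t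

theorem Piece.Fine.exists_ok {F : q → List Sym → List Sym} {S : Store} {r : Reg} {p : Piece q}
    (h : p.Fine O F S r) : ∃ B, p.Ok O F S r B := by
  cases p with
  | lit l => exact ⟨_, le_refl l.length⟩
  | reg i => exact ⟨(S i).length, h.1, h.2.1, h.2.2, le_rfl⟩
  | call a i =>
    obtain ⟨h₁, h₂, h₃, t, h₄⟩ := h
    exact ⟨(S i).length + t + (F a (S i)).length, h₁, h₂, h₃, by omega, h₄.mono (by omega),
      by omega⟩

theorem Runs.emit (F : q → List Sym → List Sym) {S S' : Store} {r : Reg} {ps : List (Piece q)}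
    (hu : S .u = []) (hv : S .v = []) (hru : r ≠ .u) (hrv : r ≠ .v)
    (hps : ∀ p ∈ ps, p.Fine O F S r)
    (h : S' = Function.update S r ((ps.map (Piece.eval F S)).flatten ++ S r)) :
    Runs O (emit r ps) S S' := by
  have : ∃ B, ∀ p ∈ ps, p.Ok O F S r B := by
    clear h
    induction ps with
    | nil => exact ⟨0, by simp⟩
    | cons p ps ih =>
      obtain ⟨B, hB⟩ := ih fun p hp => hps p (by simp [hp])
      obtain ⟨C, hC⟩ := (hps p (by simp)).exists_ok
      refine ⟨B + C, fun p' hp' => ?_⟩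
      rcases List.mem_cons.1 hp' with rfl | hp'
      · exact hC.mono (by omega)
      · exact (hB p' hp').mono (by omega)
  obtain ⟨B, hB⟩ := this
  exact h ▸ ⟨_, exec_emit F B hu hv hru hrv hB⟩

/-! ### The conditional market is computable -/

/-- Moves the ticks in register `i` up to the first separator to register `k`, and those after it to
register `j`. -/
def split (i j k : Reg) : Cmd Reg q := .loop i fun a => match a with
  | .tick => .push j .tick
  | _ => move j k

/-- In register `acc`, after `acc`, the numerators and denominators of the prices of `φ ∧ χ` and of
`χ` are written in registers `acc`, `idx` and `aux`, `ext`; this computes the conditional price. -/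
def divide : Cmd Reg q :=
  .seq (.loop .acc fun _ => emit .inp [.reg .ext]) <|
  .seq (.loop .aux fun _ => emit .expr [.reg .idx]) <|
  .seq (clear .idx) <| .seq (clear .ext) <|
  .seq (emit .aux [.reg .inp]) <| .seq (emit .acc [.reg .expr]) <|
  .seq (.loop .aux fun _ => .pop .acc fun _ => .skip) <|
  .seq (.pop .acc fun a => cond a.isSome (emit .out [.reg .inp, .lit [.sep], .reg .expr])
    (emit .out [.lit [.tick, .sep, .tick]])) <|
  .seq (clear .acc) <| .seq (clear .inp) (clear .expr)

/-- Queries the market, which is called `true`, about `φ ∧ χ` and `χ`, where `χ` is computed by the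
machine `false` from the day, and divides. -/
def condMarket : Cmd Reg Bool :=
  .seq (move .inp .acc) <|
  .seq (.loop .acc fun a => if a = .tick then .push .idx .tick else .push .buf a) <|
  .seq (.pop .buf fun _ => .skip) <|
  .seq (emit .aux [.reg .idx, .lit [.sep, .and], .reg .buf, .call false .idx]) <|
  .seq (emit .expr [.reg .idx, .lit [.sep], .call false .idx]) <|
  .seq (clear .buf) <| .seq (clear .idx) <|
  .seq (emit .buf [.call true .aux]) <| .seq (clear .aux) <| .seq (split .buf .idx .acc) <|
  .seq (emit .buf [.call true .expr]) <| .seq (clear .expr) <| .seq (split .buf .ext .aux) <|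
  divide

theorem foldl_tick (n : ℕ) (s m : ℕ) :
    (encUnary n).foldl (fun s (_ : Sym) => s + m) s = s + n * m := by
  induction n generalizing s with
  | zero => simp [encUnary]
  | succ n ih =>
    have := ih (s + m)
    simp only [encUnary, List.replicate_succ, List.foldl_cons] at this ⊢
    rw [this]; ring

theorem encUnary_add (m n : ℕ) : encUnary (m + n) = encUnary m ++ encUnary n := by
  simp [encUnary]

theorem reverse_encUnary (n : ℕ) : (encUnary n).reverse = encUnary n := by
  simp [encUnary]

theorem encUnary_succ (n : ℕ) : encUnary (n + 1) = .tick :: encUnary n := rfl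

/-- The quotient of a/b by c/d is ad/(cb). Products arise by writing a block of ticks once per tick
of the other factor. The comparison removes ad ticks from a copy of the cb ticks: a tick is left
exactly if ad < cb. Otherwise 1/1 is output, for the capped price. -/
theorem runs_divide (a b c d : ℕ) :
    Runs O divide (store [] [] (encUnary a) (encUnary c) (encUnary d) [] (encUnary b) [])
      (store [] (encPair (if a * d < c * b then (a * d, c * b) else (1, 1))) [] [] [] [] [] []) := by
  have h₁ : Runs O (.loop .acc fun _ => emit .inp [.reg .ext])
      (store [] [] (encUnary a) (encUnary c) (encUnary d) [] (encUnary b) [])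
      (store (encUnary (a * d)) [] [] (encUnary c) (encUnary d) [] (encUnary b) []) := by
    have := Runs.loop (O := O) (i := .acc) (f := fun _ => emit .inp [.reg .ext])
      (fun l s => store (encUnary s) [] l (encUnary c) (encUnary d) [] (encUnary b) [])
      (fun _ s => s + d) (by simp) (by simp) (encUnary a) 0
      fun _ _ l s => .emit (fun _ x => x) rfl rfl (by simp) (by simp) (by simp [Piece.Fine])
        (by simp [Piece.eval, add_comm s, encUnary_add])
    rw [foldl_tick, zero_add] at this
    exact this
  have h₂ : Runs O (.loop .aux fun _ => emit .expr [.reg .idx])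
      (store (encUnary (a * d)) [] [] (encUnary c) (encUnary d) [] (encUnary b) [])
      (store (encUnary (a * d)) [] [] [] (encUnary d) [] (encUnary b) (encUnary (c * b))) := by
    have := Runs.loop (O := O) (i := .aux) (f := fun _ => emit .expr [.reg .idx])
      (fun l s => store (encUnary (a * d)) [] [] l (encUnary d) [] (encUnary b) (encUnary s))
      (fun _ s => s + b) (by simp) (by simp) (encUnary c) 0
      fun _ _ l s => .emit (fun _ x => x) rfl rfl (by simp) (by simp) (by simp [Piece.Fine])
        (by simp [Piece.eval, add_comm s, encUnary_add])
    rw [foldl_tick, zero_add] at this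
    exact this
  generalize a * d = m at h₁ h₂ ⊢
  generalize c * b = n at h₁ h₂ ⊢
  have h₃ : Runs O (.loop .aux fun _ => .pop .acc fun _ => .skip)
      (store (encUnary m) [] (encUnary n) (encUnary m) [] [] [] (encUnary n))
      (store (encUnary m) [] (encUnary (n - m)) [] [] [] [] (encUnary n)) := by
    have := Runs.loop (O := O) (i := .aux) (f := fun _ => .pop .acc fun _ => .skip)
      (fun l s => store (encUnary m) [] (encUnary s) l [] [] [] (encUnary n))
      (fun _ s => s - 1) (by simp) (by simp) (encUnary m) n
      fun _ _ l s => .pop (by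
        have : (encUnary s).tail = encUnary (s - 1) := by simp [encUnary]
        simpa [this] using .skip _)
    have e : ∀ m s, (encUnary m).foldl (fun s (_ : Sym) => s - 1) s = s - m := by
      intro m
      induction m with
      | zero => simp [encUnary]
      | succ m ih =>
        intro s
        rw [encUnary_succ, List.foldl_cons, ih]
        omega
    rw [e] at this
    exact this
  refine h₁.seq (h₂.seq (.seq (.clear rfl) (.seq (.clear rfl) (.seq (.emit (fun _ x => x) rfl rfl
    (by simp) (by simp) (by simp [Piece.Fine]) rfl) (.seq (.emit (fun _ x => x) rfl rfl
    (by simp) (by simp) (by simp [Piece.Fine]) rfl) (.seq (S₁ := store (encUnary m) []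
    (encUnary (n - m)) [] [] [] [] (encUnary n)) (by simpa [Piece.eval] using h₃) ?_))))))
  refine .seq (S₁ := store (encUnary m) (encPair (if m < n then (m, n) else (1, 1)))
    (encUnary (n - m - 1)) [] [] [] [] (encUnary n)) (.pop ?_) (.seq (.clear rfl)
      (.seq (.clear rfl) (.clear (by simp))))
  have ht : (encUnary (n - m)).tail = encUnary (n - m - 1) := by simp [encUnary]
  simp only [store_acc, update_store_acc, ht]
  by_cases h : m < n
  · have : (encUnary (n - m)).head?.isSome = true := by
      simp [encUnary]; omega
    rw [this, if_pos h]
    exact .emit (fun _ x => x) rfl rfl (by simp) (by simp) (by simp [Piece.Fine])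
      (by simp [Piece.eval, encPair])
  · have : (encUnary (n - m)).head?.isSome = false := by
      simp [encUnary]; omega
    rw [this, if_neg h]
    exact .emit (fun _ x => x) rfl rfl (by simp) (by simp) (by simp [Piece.Fine])
      (by simp [Piece.eval, encPair, encUnary])

/-- Symbols that occur in sentences and rational numbers. -/
def Sym.isPlain : Sym → Bool
  | .b0 | .b1 | .sep | .minus | .atom | .neg | .and | .or | .imp | .iff => true
  | _ => false

theorem isPlain_encBits (l : List Bool) : ∀ a ∈ encBits l, a.isPlain = true := by
  intro a ha
  obtain ⟨b, -, rfl⟩ := List.mem_map.1 ha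
  cases b <;> rfl

theorem isPlain_encSentence {Atom : Type} (code : Atom → List Bool) (φ : Sentence Atom) :
    ∀ a ∈ encSentence code φ, a.isPlain = true := by
  induction φ with
  | atom x =>
    simp only [encSentence, List.mem_cons, List.mem_append, List.not_mem_nil, or_false]
    rintro a (rfl | h | rfl)
    exacts [rfl, isPlain_encBits _ a h, rfl]
  | neg φ h =>
    simp only [encSentence, List.mem_cons]
    rintro a (rfl | ha)
    exacts [rfl, h a ha]
  | and φ ψ h₁ h₂ | or φ ψ h₁ h₂ | imp φ ψ h₁ h₂ | iff φ ψ h₁ h₂ =>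
    simp only [encSentence, List.mem_cons, List.mem_append]
    rintro a (rfl | ha | ha)
    exacts [rfl, h₁ a ha, h₂ a ha]

theorem runs_split (i j k : Reg) (a b : ℕ) (S : Store) (hij : i ≠ j)
    (hik : i ≠ k) (hjk : j ≠ k) (hi : S i = encPair (a, b)) (hj : S j = []) (hk : S k = []) :
    Runs O (split i j k) S (Function.update (Function.update (Function.update S i []) j
      (encUnary b)) k (encUnary a)) := by
  have := Runs.loop (O := O) (i := i) (f := fun a => match a with
      | .tick => .push j .tick
      | _ => move j k)
    (fun l (s : List Sym × List Sym) => Function.update (Function.update (Function.update S i l) j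
      s.1) k s.2)
    (fun a s => if a = .tick then (.tick :: s.1, s.2) else ([], s.1.reverse ++ s.2))
    (by simp [hij, hik]) (by
      intro a l s
      funext r
      simp only [Function.update_apply]
      grind) (encPair (a, b)) ([], []) (by
        intro c hc l s
        have hc : c = .tick ∨ c = .sep := by
          simp only [encPair, encUnary, List.mem_append, List.mem_cons, List.mem_replicate] at hc
          tauto
        rcases hc with rfl | rfl
        · refine .push ?_
          funext r
          simp only [Function.update_apply]
          grind
        · refine .move hjk ?_
          funext r
          simp only [Function.update_apply]
          grind)
  have e : ∀ n (s t : List Sym), (encUnary n).foldl (fun (s : List Sym × List Sym) a =>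
      if a = .tick then (.tick :: s.1, s.2) else ([], s.1.reverse ++ s.2)) (s, t) =
        (encUnary n ++ s, t) := by
    intro n
    induction n with
    | zero => simp [encUnary]
    | succ n ih =>
      intro s t
      rw [encUnary_succ, List.foldl_cons, if_pos rfl, ih]
      have : encUnary n ++ .tick :: s = encUnary n ++ encUnary 1 ++ s := by simp [encUnary]
      rw [this, ← encUnary_add]; rfl
  rw [encPair, List.foldl_append, e, List.foldl_cons, if_neg (by simp), e] at this
  simp only [List.append_nil, reverse_encUnary] at this
  have h₀ : Function.update (Function.update (Function.update S i (encUnary a ++ .sep :: encUnary b))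
      j []) k [] = S := by
    funext r
    simp only [Function.update_apply, encPair] at hi ⊢
    grind
  rw [h₀] at this
  exact this

/-- Sentences contain no ticks, so sorting the symbols into ticks and others separates the day from
the sentence. The separator then heads `.buf` and is popped. -/
theorem runs_condMarket {O : Bool → Machine} {a b c d n : ℕ} {φ χ : List Sym}
    (hφ : ∀ a ∈ φ, a.isPlain = true) (hχ : ∃ t, Outputs (O false) (encUnary n) χ t)
    (h₁ : ∃ t, Outputs (O true) (encUnary n ++ .sep :: .and :: (φ ++ χ)) (encPair (a, b)) t)
    (h₂ : ∃ t, Outputs (O true) (encUnary n ++ .sep :: χ) (encPair (c, d)) t) :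
    Runs O condMarket (single .inp (encUnary n ++ .sep :: φ))
      (single .out (encPair (if a * d < c * b then (a * d, c * b) else (1, 1)))) := by
  rw [single_inp, single_out]
  have hloop := Runs.loop (O := O) (i := .acc)
    (f := fun a => if a = .tick then .push .idx .tick else .push .buf a)
    (fun l (s : List Sym × List Sym) => store [] [] l [] [] s.1 s.2 [])
    (fun a s => if a = .tick then (s.1, .tick :: s.2) else (a :: s.1, s.2)) (by simp) (by simp)
    (encUnary n ++ .sep :: φ).reverse ([], []) (by
      intro a _ l s
      by_cases h : a = .tick
      · subst h; simpa using Runs.push (by simp)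
      · simpa [h] using Runs.push (by simp))
  have e₁ : ∀ l : List Sym, (∀ a ∈ l, a.isPlain = true) → ∀ s : List Sym × List Sym,
      l.foldr (fun a s => if a = .tick then (s.1, .tick :: s.2) else (a :: s.1, s.2)) s =
        (l ++ s.1, s.2) := by
    intro l
    induction l with
    | nil => simp
    | cons a l ih =>
      intro hl s
      have : a ≠ .tick := by rintro rfl; exact absurd (hl .tick (by simp)) (by decide)
      rw [List.foldr_cons, ih (fun b hb => hl b (by simp [hb])), if_neg this]; rfl
  have e₂ : ∀ m, ∀ s : List Sym × List Sym, (encUnary m).foldr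
      (fun a s => if a = .tick then (s.1, .tick :: s.2) else (a :: s.1, s.2)) s =
        (s.1, encUnary m ++ s.2) := by
    intro m s
    induction m with
    | zero => rfl
    | succ m ih => rw [encUnary_succ, List.foldr_cons, ih, if_pos rfl]; rfl
  rw [List.foldl_reverse, List.foldr_append, e₁ (.sep :: φ) (by simpa [Sym.isPlain] using hφ),
    e₂] at hloop
  simp only [List.append_nil] at hloop
  refine .seq (S₁ := store [] [] (encUnary n ++ .sep :: φ).reverse [] [] [] [] [])
    (.move (by simp) (by simp)) (.seq hloop (.seq (S₁ := store [] [] [] [] [] φ (encUnary n) [])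
    (.pop (by simpa using .skip _)) ?_))
  refine .seq (S₁ := store [] [] [] (encUnary n ++ .sep :: .and :: (φ ++ χ)) [] φ (encUnary n) [])
    (.emit (fun _ _ => χ) rfl rfl (by simp) (by simp) (by simpa [Piece.Fine] using hχ)
      (by simp [Piece.eval])) ?_
  refine .seq (S₁ := store [] [] [] (encUnary n ++ .sep :: .and :: (φ ++ χ)) [] φ (encUnary n)
      (encUnary n ++ .sep :: χ))
    (.emit (fun _ _ => χ) rfl rfl (by simp) (by simp) (by simpa [Piece.Fine] using hχ)
      (by simp [Piece.eval])) ?_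
  refine .seq (.clear rfl) (.seq (S₁ := store [] [] [] (encUnary n ++ .sep :: .and :: (φ ++ χ)) []
    [] [] (encUnary n ++ .sep :: χ)) (.clear (by simp)) ?_)
  refine .seq (S₁ := store [] [] [] (encUnary n ++ .sep :: .and :: (φ ++ χ)) [] (encPair (a, b)) []
      (encUnary n ++ .sep :: χ))
    (.emit (fun _ _ => encPair (a, b)) rfl rfl (by simp) (by simp) (by simpa [Piece.Fine] using h₁)
      (by simp [Piece.eval])) ?_
  refine .seq (S₁ := store [] [] [] [] [] (encPair (a, b)) [] (encUnary n ++ .sep :: χ))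
    (.clear (by simp)) (.seq (runs_split .buf .idx .acc a b _ (by simp) (by simp) (by simp) rfl rfl
      rfl) ?_)
  simp only [update_store_buf, update_store_idx, update_store_acc]
  refine .seq (S₁ := store [] [] (encUnary a) [] [] (encPair (c, d)) (encUnary b)
      (encUnary n ++ .sep :: χ))
    (.emit (fun _ _ => encPair (c, d)) rfl rfl (by simp) (by simp) (by simpa [Piece.Fine] using h₂)
      (by simp [Piece.eval])) ?_
  refine .seq (S₁ := store [] [] (encUnary a) [] [] (encPair (c, d)) (encUnary b) [])
    (.clear (by simp)) (.seq (runs_split .buf .ext .aux c d _ (by simp) (by simp) (by simp) rfl rfl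
      rfl) ?_)
  simp only [update_store_buf, update_store_ext, update_store_aux]
  exact runs_divide a b c d

theorem IsMarket.cond {Atom : Type} {code : Atom → List Bool} {P : ℕ → Valuation Atom}
    (hP : IsMarket code P) {χ : ℕ → Sentence Atom} (hχ : EffComputable (encSentence code) χ) :
    IsMarket code (fun n => (P n).cond (χ n)) := by
  obtain ⟨h01, r, hr, hPr⟩ := hP
  refine ⟨fun n φ => ?_, ?_⟩
  · simp only [Valuation.cond]
    split_ifs with h
    · have h₀ := (h01 n (.and φ (χ n))).1
      exact ⟨div_nonneg h₀ (h₀.trans h.le), div_le_one_of_le₀ h.le (h₀.trans h.le)⟩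
    · exact ⟨zero_le_one, le_rfl⟩
  · obtain ⟨s, M, p, hM⟩ := hr.computableIn
    obtain ⟨N, p', hN⟩ := (computableIn_iff_effComputable _ _).2 hχ
    set r' : ℕ × Sentence Atom → ℕ × ℕ := fun x =>
      if (r (x.1, .and x.2 (χ x.1))).1 * (r (x.1, χ x.1)).2 <
          (r (x.1, χ x.1)).1 * (r (x.1, .and x.2 (χ x.1))).2 then
        ((r (x.1, .and x.2 (χ x.1))).1 * (r (x.1, χ x.1)).2,
          (r (x.1, χ x.1)).1 * (r (x.1, .and x.2 (χ x.1))).2) else (1, 1) with hr'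
    refine ⟨r', ?_, fun n φ => ?_⟩
    · have h : ∀ x, Runs (fun b : Bool => if b then M else N) condMarket
          (single .inp (encDaySentence code x)) (single .out (encPair (r' x))) := by
        rintro ⟨n, φ⟩
        exact runs_condMarket (isPlain_encSentence code φ) ⟨_, hN n⟩ ⟨_, hM (n, .and φ (χ n))⟩
          ⟨_, hM (n, χ n)⟩
      choose t ht using h
      exact (computableIn_of_exec _ _ (s := t) .X fun x => by simpa using ht x).tmComputable
    · obtain ⟨h₁, e₁⟩ := hPr n (.and φ (χ n))
      obtain ⟨h₂, e₂⟩ := hPr n (χ n)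
      simp only [hr', Valuation.cond, e₁, e₂]
      generalize r (n, .and φ (χ n)) = x at h₁ ⊢
      generalize r (n, χ n) = y at h₂ ⊢
      have hx : (0 : ℝ) < x.2 := by exact_mod_cast Nat.pos_of_ne_zero h₁
      have hy : (0 : ℝ) < y.2 := by exact_mod_cast Nat.pos_of_ne_zero h₂
      have hiff : (x.1 : ℝ) / x.2 < y.1 / y.2 ↔ x.1 * y.2 < y.1 * x.2 := by
        rw [div_lt_div_iff₀ hx hy]
        exact_mod_cast Iff.rfl
      by_cases h : x.1 * y.2 < y.1 * x.2
      · rw [if_pos h, if_pos (hiff.2 h)]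
        -- The strict inequality rules out that the price of `χ n` is 0, so the new denominator does
        -- not vanish.
        have hy1 : y.1 ≠ 0 := by rintro h0; simp [h0] at h
        refine ⟨mul_ne_zero hy1 h₁, ?_⟩
        push_cast
        have : (y.1 : ℝ) ≠ 0 := by exact_mod_cast hy1
        field_simp
      · rw [if_neg h, if_neg (mt hiff.1 h)]
        simp

end LogicalInduction

/-! ### Part: rewriting a strategy as a fold over its symbols. -/

namespace LogicalInduction

/-! ### Rewriting strategies from right to left -/

/-- The feature `priceCond`, given the strings for `χ`, `φ` and the day in unary. -/
def priceWord (c : ℕ) (χ φ i : List Sym) : List (List Sym) :=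
  [[.add, .const] ++ encRat 1 ++ [.mul, .const] ++ encRat (-c) ++ [.mul, .max, .const] ++ encRat 0 ++
    [.add, .price], χ, i, [.sep, .mul, .const] ++ encRat (-1) ++ [.price, .and], φ, χ, i,
    [.sep, .safeInv, .mul, .const] ++ encRat c ++ [.price], χ, i, [.sep]]

/-- The feature `reducedAmount`, where `z` consists of as many zeros as the binary notation of the
factor has. -/
def amountWord (χ φ i z ξ : List Sym) : List (List Sym) :=
  [[.mul], ξ, [.safeInv, .mul, .const], z, [.b1, .sep, .b1, .sep, .mul], ξ,
    [.max, .const] ++ encRat 0 ++ [.add, .price, .and], φ, χ, i,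
    [.sep, .mul, .const] ++ encRat (-1) ++ [.price], χ, i, [.sep]]

/-- The trades `condTrade`. -/
def tradeWord (c : ℕ) (χ φ i z ξ : List Sym) : List (List Sym) :=
  [[.trade, .and], φ, χ] ++ amountWord χ φ i z ξ ++
    [[.trade], χ, [.mul, .const] ++ encRat (-1) ++ [.mul]] ++ priceWord c χ φ i ++
      amountWord χ φ i z ξ

/-- The state of the rewriting: the plain symbols and the number of ticks of the current token, the
current feature and the output. -/
structure Rewriting where
  buf : List Sym
  idx : ℕ
  expr : List Sym
  out : List Sym

/-- Processes one symbol. -/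
def Rewriting.step (χ : ℕ → List Sym) (c n : ℕ) (z : List Sym) (a : Sym) (s : Rewriting) :
    Rewriting :=
  match a with
  | .tick => { s with idx := s.idx + 1 }
  | .price => ⟨[], 0,
      (priceWord c (χ s.idx) s.buf.dropLast (encUnary s.idx)).flatten ++ s.expr, s.out⟩
  | .const | .var => ⟨[], 0, a :: (encUnary s.idx ++ s.buf ++ s.expr), s.out⟩
  | .add | .mul | .max | .safeInv => { s with expr := a :: s.expr }
  | .define => { s with expr := [], out := .define :: (s.expr ++ s.out) }
  | .trade => ⟨[], s.idx, [], (tradeWord c (χ n) s.buf (encUnary n) z s.expr).flatten ++ s.out⟩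
  | _ => { s with buf := a :: s.buf }

section Correct

variable {Atom : Type} (code : Atom → List Bool) (χ : ℕ → Sentence Atom) (c n : ℕ) (z : List Sym)

theorem flatten_priceWord (φ : Sentence Atom) (i : ℕ) :
    (priceWord c (encSentence code (χ i)) (encSentence code φ) (encUnary i)).flatten =
      encFeatExpr code (priceCond c (χ i) φ i) := by
  simp [priceWord, priceCond, encFeatExpr, encSentence]

/-- Binary digits are listed with the least significant first. With a power of two as the factor
`K`, writing it down amounts to copying a string of zeros, without any arithmetic. -/
theorem encRat_two_pow (k : ℕ) :
    encRat (2 ^ k) = List.replicate k .b0 ++ [.b1, .sep, .b1, .sep] := by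
  have h₁ : ((2 : ℚ) ^ k).num = 2 ^ k := by
    have : (2 : ℚ) ^ k = ((2 ^ k : ℤ) : ℚ) := by push_cast; rfl
    rw [this, Rat.num_intCast]
  have h₂ : ((2 : ℚ) ^ k).den = 1 := by
    have : (2 : ℚ) ^ k = ((2 ^ k : ℤ) : ℚ) := by push_cast; rfl
    rw [this, Rat.den_intCast]
  have h₃ : ¬ (2 : ℚ) ^ k < 0 := not_lt.2 (by positivity)
  have h₄ : ∀ k, (2 ^ k : ℕ).bits = List.replicate k false ++ [true] := by
    intro k
    induction k with
    | zero => simp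
    | succ k ih =>
      rw [pow_succ, mul_comm, Nat.bit0_bits _ (by positivity), ih]; rfl
  simp [encRat, h₁, h₂, h₃, Int.natAbs_pow, h₄, encBits]

theorem flatten_tradeWord (k : ℕ) (t : Sentence Atom × FeatExpr Atom) :
    (tradeWord c (encSentence code (χ n)) (encSentence code t.1) (encUnary n)
      (List.replicate k .b0) (encFeatExpr code (t.2.condition c χ))).flatten =
      (condTrade c (2 ^ k) χ n t).flatMap
        fun t => Sym.trade :: (encSentence code t.1 ++ encFeatExpr code t.2) := by
  have h := flatten_priceWord code χ c t.1 n
  simp only [tradeWord, List.flatten_append, h]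
  simp [amountWord, condTrade, reducedAmount, encFeatExpr, encSentence, encRat_two_pow]

variable {code χ c n z}

theorem foldr_plain {x : ℕ → List Sym} {l : List Sym} (hl : ∀ a ∈ l, a.isPlain = true)
    (s : Rewriting) :
    l.foldr (Rewriting.step x c n z) s = { s with buf := l ++ s.buf } := by
  induction l with
  | nil => rfl
  | cons a l ih =>
    rw [List.foldr_cons, ih fun b hb => hl b (by simp [hb])]
    have := hl a (by simp)
    cases a <;> first | rfl | cases this

theorem foldr_unary {x : ℕ → List Sym} (k : ℕ) (s : Rewriting) :
    (encUnary k).foldr (Rewriting.step x c n z) s = { s with idx := s.idx + k } := by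
  induction k with
  | zero => rfl
  | succ k ih => rw [encUnary_succ, List.foldr_cons, ih]; rfl

theorem isPlain_encRat (r : ℚ) : ∀ a ∈ encRat r, a.isPlain = true := by
  intro a ha
  simp only [encRat, List.mem_append, List.mem_cons, List.not_mem_nil, or_false] at ha
  rcases ha with (((h | h) | rfl) | h) | rfl
  · split_ifs at h
    · rw [List.mem_singleton.1 h]; rfl
    · simp at h
  · exact isPlain_encBits _ a h
  · rfl
  · exact isPlain_encBits _ a h
  · rfl

/-- In prefix notation read from the right, the operands stand rewritten at the front of `expr` when
their operator is met, so the operator is simply put before them and no parsing stack is needed.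
Only prices change, and they are leaves. -/
theorem foldr_encFeatExpr (e : FeatExpr Atom) :
    ∀ s o, (encFeatExpr code e).foldr (Rewriting.step (fun i => encSentence code (χ i)) c n z)
      ⟨[], 0, s, o⟩ = ⟨[], 0, encFeatExpr code (e.condition c χ) ++ s, o⟩ := by
  induction e with
  | price φ i =>
    intro s o
    -- The separator after the day is read first and ends up last in `buf`, where the step for
    -- `.price` drops it.
    rw [encFeatExpr, List.foldr_cons, List.foldr_append, List.foldr_append,
      foldr_plain (l := [.sep]) (by simp [Sym.isPlain]), foldr_unary,
      foldr_plain (isPlain_encSentence code φ)]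
    simp [Rewriting.step, flatten_priceWord, FeatExpr.condition]
  | const q =>
    intro s o
    rw [encFeatExpr, List.foldr_cons, foldr_plain (isPlain_encRat q)]
    simp [Rewriting.step, FeatExpr.condition, encUnary, encFeatExpr]
  | var j =>
    intro s o
    rw [encFeatExpr, List.foldr_cons, List.foldr_append,
      foldr_plain (l := [.sep]) (by simp [Sym.isPlain]), foldr_unary]
    simp [Rewriting.step, FeatExpr.condition, encFeatExpr]
  | add e f he hf | mul e f he hf | max e f he hf =>
    intro s o
    rw [encFeatExpr, List.foldr_cons, List.foldr_append, hf, he]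
    simp [Rewriting.step, FeatExpr.condition, encFeatExpr]
  | safeInv e he =>
    intro s o
    rw [encFeatExpr, List.foldr_cons, he]
    simp [Rewriting.step, FeatExpr.condition, encFeatExpr]

theorem foldr_encStrategy (k : ℕ) (T : Strategy Atom) :
    (encStrategy code T).foldr (Rewriting.step (fun i => encSentence code (χ i)) c n
      (List.replicate k .b0)) ⟨[], 0, [], []⟩ =
        ⟨[], 0, [], encStrategy code (T.condition c (2 ^ k) χ n)⟩ := by
  have h₁ : ∀ l : List (Sentence Atom × FeatExpr Atom), (l.flatMap fun t =>
      Sym.trade :: (encSentence code t.1 ++ encFeatExpr code t.2)).foldr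
        (Rewriting.step (fun i => encSentence code (χ i)) c n (List.replicate k .b0))
          ⟨[], 0, [], []⟩ = ⟨[], 0, [], (l.flatMap (condTrade c (2 ^ k) χ n)).flatMap fun t =>
            Sym.trade :: (encSentence code t.1 ++ encFeatExpr code t.2)⟩ := by
    intro l
    induction l with
    | nil => rfl
    | cons t l ih =>
      rw [List.flatMap_cons, List.foldr_append, ih, List.foldr_cons, List.foldr_append,
        foldr_encFeatExpr, foldr_plain (isPlain_encSentence code t.1), List.flatMap_cons,
        List.flatMap_append, ← flatten_tradeWord]
      simp [Rewriting.step]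
  have h₂ : ∀ (l : List (FeatExpr Atom)) (o : List Sym), (l.flatMap fun e =>
      Sym.define :: encFeatExpr code e).foldr
        (Rewriting.step (fun i => encSentence code (χ i)) c n (List.replicate k .b0))
          ⟨[], 0, [], o⟩ = ⟨[], 0, [], ((l.map (FeatExpr.condition c χ)).flatMap fun e =>
            Sym.define :: encFeatExpr code e) ++ o⟩ := by
    intro l o
    induction l with
    | nil => rfl
    | cons e l ih =>
      rw [List.flatMap_cons, List.foldr_append, ih, List.foldr_cons, foldr_encFeatExpr]
      simp [Rewriting.step]
  rw [encStrategy, List.foldr_append, h₁, h₂]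
  rfl

end Correct

/-! ### The rewriting program -/

/-- `priceWord` as a list of parts. -/
def pricePieces (c : ℕ) (χ φ i : Piece Bool) : List (Piece Bool) :=
  [.lit ([.add, .const] ++ encRat 1 ++ [.mul, .const] ++ encRat (-c) ++ [.mul, .max, .const] ++
    encRat 0 ++ [.add, .price]), χ, i, .lit ([.sep, .mul, .const] ++ encRat (-1) ++ [.price, .and]),
    φ, χ, i, .lit ([.sep, .safeInv, .mul, .const] ++ encRat c ++ [.price]), χ, i, .lit [.sep]]

/-- `amountWord` as a list of parts. -/
def amountPieces (χ φ i z ξ : Piece Bool) : List (Piece Bool) :=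
  [.lit [.mul], ξ, .lit [.safeInv, .mul, .const], z, .lit [.b1, .sep, .b1, .sep, .mul], ξ,
    .lit ([.max, .const] ++ encRat 0 ++ [.add, .price, .and]), φ, χ, i,
    .lit ([.sep, .mul, .const] ++ encRat (-1) ++ [.price]), χ, i, .lit [.sep]]

/-- `tradeWord` as a list of parts. -/
def tradePieces (c : ℕ) (χ φ i z ξ : Piece Bool) : List (Piece Bool) :=
  [.lit [.trade, .and], φ, χ] ++ amountPieces χ φ i z ξ ++
    [.lit [.trade], χ, .lit ([.mul, .const] ++ encRat (-1) ++ [.mul])] ++ pricePieces c χ φ i ++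
      amountPieces χ φ i z ξ

/-- Processes one symbol; the machine `false` computes `χ`. -/
def rewriteStep (c : ℕ) (a : Sym) : Cmd Reg Bool :=
  match a with
  | .tick => .push .idx .tick
  | .price => .seq (move .buf .v) <| .seq (.pop .v fun _ => .skip) <| .seq (move .v .buf) <|
      .seq (emit .expr (pricePieces c (.call false .idx) (.reg .buf) (.reg .idx))) <|
      .seq (clear .buf) (clear .idx)
  | .const | .var => .seq (emit .expr [.lit [a], .reg .idx, .reg .buf]) <|
      .seq (clear .buf) (clear .idx)
  | .add | .mul | .max | .safeInv => .push .expr a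
  | .define => .seq (emit .out [.lit [.define], .reg .expr]) (clear .expr)
  | .trade => .seq (emit .out (tradePieces c (.call false .inp) (.reg .buf) (.reg .inp) (.reg .ext)
      (.reg .expr))) <| .seq (clear .buf) (clear .expr)
  | _ => .push .buf a

/-- Rewrites the strategy computed by the machine `true`. -/
def rewrite (c : ℕ) : Cmd Reg Bool :=
  .seq (emit .aux [.reg .inp, .call true .inp]) <|
  .seq (.loop .aux fun a => .seq (.push .ext .b0) (.push .acc a)) <|
  .seq (.loop .acc (rewriteStep c)) <|
  .seq (clear .inp) <| .seq (clear .ext) <| .seq (clear .buf) <| .seq (clear .idx) (clear .expr)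

/-- A bound on the length of the strings used by `rewriteStep`. -/
def litBound (c : ℕ) : ℕ :=
  20 + (encRat 1).length + (encRat 0).length + (encRat (-1)).length + (encRat c).length +
    (encRat (-c)).length

end LogicalInduction

/-! ### Part: the rewriting program runs in polynomial time. -/

namespace LogicalInduction

/-- The most expensive symbol is `.trade`, which emits 45 parts at a cost of `12 * B + 6` each; the
factor 60 leaves room for emptying registers. -/
theorem exec_rewriteStep {O : Bool → Machine} {c n B : ℕ} {x : ℕ → List Sym} {z l : List Sym}
    (a : Sym) (s : Rewriting) (hc : litBound c ≤ B) (hn : n ≤ B) (hz : z.length ≤ B)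
    (hbuf : s.buf.length ≤ B) (hidx : s.idx ≤ B) (hexpr : s.expr.length ≤ B)
    (hx : ∀ i, i = n ∨ i = s.idx → Outputs (O false) (encUnary i) (x i) B ∧ (x i).length ≤ B) :
    Exec O (rewriteStep c a)
      (store (encUnary n) s.out l [] z s.buf (encUnary s.idx) s.expr)
      (store (encUnary n) (s.step x c n z a).out l [] z (s.step x c n z a).buf
        (encUnary (s.step x c n z a).idx) (s.step x c n z a).expr) (60 * (12 * B + 6)) := by
  have hb : ∀ i, (encUnary i).length = i := by simp [encUnary]
  have hX : ∀ i, i = n ∨ i = s.idx → Outputs (O false) (encUnary i)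
      ((fun (_ : Bool) (y : List Sym) => x y.length) false (encUnary i)) B ∧
      ((fun (_ : Bool) (y : List Sym) => x y.length) false (encUnary i)).length ≤ B := by
    simpa only [hb] using hx
  have hX₁ := hX n (.inl rfl)
  have hX₂ := hX s.idx (.inr rfl)
  have hlit : litBound c ≤ B := hc
  unfold litBound at hlit
  have hpush : ∀ (r : Reg) (a : Sym) (S S' : Store), Function.update S r (a :: S r) = S' →
      Exec O (.push r a) S S' (60 * (12 * B + 6)) := fun r a S S' h =>
    (Exec.push _ _ _ _ le_rfl).of_eq h (by omega)
  have hcv : ∀ a : Sym, Exec O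
      (.seq (emit .expr [.lit [a], .reg .idx, .reg .buf]) (.seq (clear .buf) (clear .idx)))
      (store (encUnary n) s.out l [] z s.buf (encUnary s.idx) s.expr)
      (store (encUnary n) s.out l [] z [] [] (a :: (encUnary s.idx ++ s.buf ++ s.expr)))
      (60 * (12 * B + 6)) := by
    intro a
    refine .seq ((exec_emit (fun _ y => x y.length) B rfl rfl (by simp) (by simp) (by
      simp [Piece.Ok, hb]; omega)).of_eq rfl le_rfl)
      (.seq (exec_clear _ _) ((exec_clear _ _).of_eq ?_ le_rfl) le_rfl) ?_
    · simp [Piece.eval]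
    · simp [hb]; omega
  cases a with
  | tick => exact hpush _ _ _ _ (by simp [Rewriting.step, encUnary_succ])
  | price =>
    have h₁ := exec_move (O := O) (i := .buf) (j := .v) (by simp)
      (store (encUnary n) s.out l [] z s.buf (encUnary s.idx) s.expr)
    have h₂ : Exec O (.pop .v fun _ => .skip) (Function.update (store (encUnary n) s.out l [] z []
        (encUnary s.idx) s.expr) .v s.buf.reverse) (Function.update (store (encUnary n) s.out l [] z
        [] (encUnary s.idx) s.expr) .v s.buf.reverse.tail) 1 :=
      .pop ((Exec.skip _ 0).of_eq (by simp) le_rfl) le_rfl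
    have h₃ := exec_move (O := O) (i := .v) (j := .buf) (by simp) (Function.update
      (store (encUnary n) s.out l [] z [] (encUnary s.idx) s.expr) .v s.buf.reverse.tail)
    have e : Function.update (store (encUnary n) s.out l [] z [] (encUnary s.idx) s.expr) .v [] =
        store (encUnary n) s.out l [] z [] (encUnary s.idx) s.expr := Function.update_eq_self _ _
    have e' : s.buf.reverse.tail.reverse = s.buf.dropLast := by simp
    simp only [update_store_buf, store_buf, store_v, List.append_nil] at h₁
    simp only [Function.update_idem, Function.update_self, e, e', update_store_buf, store_buf,
      List.append_nil, List.length_tail, List.length_reverse,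
      Function.update_of_ne (show Reg.buf ≠ Reg.v by simp)] at h₃
    refine .seq h₁ (.seq h₂ (.seq h₃ (.seq (exec_emit (fun _ y => x y.length) B rfl rfl (by simp)
      (by simp) ?_) (.seq (exec_clear _ _) ((exec_clear _ _).of_eq ?_ le_rfl) le_rfl)
        le_rfl) le_rfl) le_rfl) ?_
    · simp only [hb] at hX₂
      simp [pricePieces, Piece.Ok, hb, hidx, hX₂]
      omega
    · simp [pricePieces, priceWord, Piece.eval, Rewriting.step, encUnary]
    · simp [pricePieces, hb]; omega
  | const => exact (hcv .const).of_eq (by simp [Rewriting.step, encUnary]) le_rfl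
  | var => exact (hcv .var).of_eq (by simp [Rewriting.step, encUnary]) le_rfl
  | add => exact hpush _ _ _ _ (by simp [Rewriting.step])
  | mul => exact hpush _ _ _ _ (by simp [Rewriting.step])
  | max => exact hpush _ _ _ _ (by simp [Rewriting.step])
  | safeInv => exact hpush _ _ _ _ (by simp [Rewriting.step])
  | define =>
    refine .seq (exec_emit (fun _ y => x y.length) B rfl rfl (by simp) (by simp) (by
      simp [Piece.Ok]; omega)) ((exec_clear _ _).of_eq ?_ le_rfl) ?_
    · simp [Piece.eval, Rewriting.step]
    · simp; omega
  | trade =>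
    refine .seq (exec_emit (fun _ y => x y.length) B rfl rfl (by simp) (by simp) ?_)
      (.seq (exec_clear _ _) ((exec_clear _ _).of_eq ?_ le_rfl) le_rfl) ?_
    · simp only [hb] at hX₁
      simp [tradePieces, amountPieces, pricePieces, Piece.Ok, hb, hn, hz, hbuf, hexpr, hX₁]
      omega
    · simp [tradePieces, tradeWord, amountPieces, amountWord, pricePieces, priceWord, Piece.eval,
        Rewriting.step, hb]
    · simp [tradePieces, amountPieces, pricePieces]; omega
  | _ => exact hpush _ _ _ _ (by simp [Rewriting.step])

/-- The growth of `expr` is largest for a price, which is replaced by 11 parts of length at most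
`B`. It is additive, so the size stays polynomial over the whole pass. -/
theorem length_step {c n B : ℕ} {x : ℕ → List Sym} {z : List Sym} (a : Sym) (s : Rewriting)
    (hc : litBound c ≤ B) (hbuf : s.buf.length ≤ B) (hidx : s.idx ≤ B)
    (hx : (x s.idx).length ≤ B) :
    (s.step x c n z a).buf.length ≤ s.buf.length + 1 ∧ (s.step x c n z a).idx ≤ s.idx + 1 ∧
      (s.step x c n z a).expr.length ≤ s.expr.length + 11 * B := by
  unfold litBound at hc
  cases a <;> simp [Rewriting.step, priceWord, encUnary] <;> omega

theorem exec_rewrite {O : Bool → Machine} {c n L B : ℕ} {x : ℕ → List Sym} {w : List Sym}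
    (hL : n + w.length ≤ L) (hc : litBound c ≤ B) (hLB : L ≤ B)
    (hw : Outputs (O true) (encUnary n) w B)
    (hx : ∀ i ≤ L, Outputs (O false) (encUnary i) (x i) B ∧ (x i).length ≤ B) :
    Exec O (rewrite c) (single .inp (encUnary n))
      (single .out (w.foldr (Rewriting.step x c n (List.replicate (n + w.length) .b0))
        ⟨[], 0, [], []⟩).out) (L * (60 * (12 * (L * (11 * B) + B) + 6) + 1) + 50 * B + 50 +
          L * (11 * B)) := by
  set z := List.replicate (n + w.length) Sym.b0 with hz
  -- With the day in front of the strategy, one zero per symbol gives the `n + w.length` zeros of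
  -- the factor `K`. The ticks of the day are processed last and only raise `idx`, which is emptied
  -- afterwards.
  set w' := encUnary n ++ w with hw'
  have hlen : w'.length = n + w.length := by simp [hw', encUnary]
  have h₁ : Exec O (emit .aux [.reg .inp, .call true .inp]) (single .inp (encUnary n))
      (store (encUnary n) [] [] w' [] [] [] []) (2 * (12 * B + 6)) := by
    rw [single_inp]
    refine (exec_emit (fun _ _ => w) B rfl rfl (by simp) (by simp) ?_).of_eq ?_ (by simp)
    · simp [Piece.Ok, encUnary] at hw ⊢
      refine ⟨by omega, hw, by omega⟩
    · simp [Piece.eval, hw']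
  have h₂ := exec_loop (O := O) (i := .aux) (f := fun a => .seq (.push .ext .b0) (.push .acc a))
    (fun l (s : List Sym × List Sym) => store (encUnary n) [] s.1 l s.2 [] [] [])
    (fun a s => (a :: s.1, .b0 :: s.2)) (fun _ _ => True) 2 (by simp) (by simp)
    (fun a l s _ => ⟨.seq (.push _ _ _ _ le_rfl) ((Exec.push _ _ _ 1 le_rfl).of_eq (by simp) le_rfl)
      le_rfl, trivial⟩) w' ([], []) trivial
  have e₂ : ∀ (l : List Sym) (s : List Sym × List Sym),
      l.foldl (fun s a => (a :: s.1, Sym.b0 :: s.2)) s =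
        (l.reverse ++ s.1, List.replicate l.length .b0 ++ s.2) := by
    intro l
    induction l with
    | nil => simp
    | cons a l ih =>
      intro s
      rw [List.foldl_cons, ih, List.length_cons, List.replicate_succ']
      simp
  rw [e₂, hlen, ← hz] at h₂
  simp only [List.append_nil] at h₂
  have h₃ := exec_loop (O := O) (i := .acc) (f := rewriteStep c)
    (fun l (s : Rewriting) => store (encUnary n) s.out l [] z s.buf (encUnary s.idx) s.expr)
    (fun a s => s.step x c n z a)
    -- The invariant reserves for each symbol still to be read the growth that it may cause.
    (fun l s => s.buf.length + l.length ≤ L ∧ s.idx + l.length ≤ L ∧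
      s.expr.length + l.length * (11 * B) ≤ L * (11 * B)) (60 * (12 * (L * (11 * B) + B) + 6))
    (by simp) (by simp) (by
      rintro a l s ⟨hb, hi, he⟩
      rw [List.length_cons] at hb hi he
      have hB : B ≤ L * (11 * B) + B := by omega
      have hx' : ∀ i, i = n ∨ i = s.idx → Outputs (O false) (encUnary i) (x i) B ∧
          (x i).length ≤ B := by
        rintro i (rfl | rfl)
        · exact hx _ (by omega)
        · exact hx _ (by omega)
      refine ⟨exec_rewriteStep a s (by omega) (by omega) (by simp [hz]; omega) (by omega) (by omega)
        ?_ fun i hi => ⟨(hx' i hi).1.mono hB, (hx' i hi).2.trans hB⟩, ?_⟩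
      · have := Nat.zero_le ((l.length + 1) * (11 * B))
        omega
      · obtain ⟨g₁, g₂, g₃⟩ := length_step (z := z) (n := n) a s hc (by omega) (by omega)
          (hx' s.idx (.inr rfl)).2
        rw [add_one_mul] at he
        exact ⟨by omega, by omega, by omega⟩) w'.reverse ⟨[], 0, [], []⟩
    ⟨by simp [hlen, hL], by simp [hlen, hL], by
      simp only [List.length_nil, zero_add, List.length_reverse, hlen]
      gcongr⟩
  rw [List.foldl_reverse, hw', List.foldr_append] at h₃
  -- The sizes of the final state determine the cost of emptying the registers.
  have hinv : ∀ (l : List Sym), l.length ≤ L → (l.foldr (fun a s => Rewriting.step x c n z a s)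
      ⟨[], 0, [], []⟩).buf.length ≤ l.length ∧ (l.foldr (fun a s => Rewriting.step x c n z a s)
      ⟨[], 0, [], []⟩).idx ≤ l.length ∧ (l.foldr (fun a s => Rewriting.step x c n z a s)
      ⟨[], 0, [], []⟩).expr.length ≤ l.length * (11 * B) := by
    intro l hl
    induction l with
    | nil => simp
    | cons a l ih =>
      rw [List.length_cons] at hl
      obtain ⟨i₁, i₂, i₃⟩ := ih (by omega)
      obtain ⟨g₁, g₂, g₃⟩ := length_step (z := z) (n := n) a _ hc (by omega) (by omega)
          (hx _ (i₂.trans (by omega))).2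
      rw [List.foldr_cons, List.length_cons, add_one_mul]
      exact ⟨by omega, by omega, by omega⟩
  obtain ⟨i₁, i₂, i₃⟩ := hinv w (by omega)
  rw [foldr_unary] at h₃
  set s := w.foldr (fun a s => Rewriting.step x c n z a s) ⟨[], 0, [], []⟩ with hs
  have i₄ : s.expr.length ≤ L * (11 * B) := i₃.trans (by gcongr; omega)
  refine .seq h₁ (.seq h₂ (.seq h₃ (.seq (exec_clear _ _) (.seq (exec_clear _ _)
    (.seq (exec_clear _ _) (.seq (exec_clear _ _) ((exec_clear _ _).of_eq ?_ le_rfl) le_rfl) le_rfl)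
      le_rfl) le_rfl) le_rfl) le_rfl) ?_
  · simp [single_out, hs]
  · have h₅ : (encUnary n ++ w).reverse.length * (60 * (12 * (L * (11 * B) + B) + 6) + 1) ≤
        L * (60 * (12 * (L * (11 * B) + B) + 6) + 1) := by
      rw [← hw', List.length_reverse, hlen]; gcongr
    simp only [update_store_inp, update_store_ext, update_store_buf, update_store_idx, store_inp,
      store_ext, store_buf, store_idx, store_expr]
    have h₆ : (encUnary n).length = n := by simp [encUnary]
    have h₇ : (encUnary (s.idx + n)).length = s.idx + n := by simp [encUnary]
    have h₈ : z.length = n + w.length := by simp [hz]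
    omega

theorem effComputable_condition {Atom : Type} {code : Atom → List Bool} {χ : ℕ → Sentence Atom}
    {T : ℕ → Strategy Atom} (c : ℕ) (hχ : EffComputable (encSentence code) χ)
    (hT : EffComputable (encStrategy code) T) :
    EffComputable (encStrategy code) (fun n =>
      (T n).condition c (2 ^ (n + (encStrategy code (T n)).length)) χ n) := by
  rw [← computableIn_iff_effComputable] at hχ hT ⊢
  obtain ⟨M, p, hM⟩ := hT.exists_bound (by simp [encUnary])
  obtain ⟨N, r, hN⟩ := hχ.exists_bound (by simp [encUnary])
  -- Days are written in unary, so every day mentioned is at most the length of the text. The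
  -- machine for `χ` is thus called on arguments up to `Lp` only, which accounts for `r.comp Lp`.
  let Lp : Polynomial ℕ := .X + p
  let Bp : Polynomial ℕ := .C (litBound c) + Lp + r.comp Lp
  refine computableIn_of_exec (fun b : Bool => if b then M else N) (rewrite c)
    (Lp * (60 * (12 * (Lp * (11 * Bp) + Bp) + 6) + 1) + 50 * Bp + 50 + Lp * (11 * Bp)) fun n => ?_
  have hL : Lp.eval n = n + p.eval n := by simp [Lp]
  have hB : Bp.eval n = litBound c + Lp.eval n + r.eval (Lp.eval n) := by
    simp [Bp, Polynomial.eval_comp]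
  have := exec_rewrite (O := fun b : Bool => if b then M else N) (c := c) (n := n)
    (L := Lp.eval n) (B := Bp.eval n) (x := fun i => encSentence code (χ i))
    (w := encStrategy code (T n)) (by rw [hL]; have := (hM n).2; omega) (by omega) (by omega)
    ((hM n).1.mono (by omega)) fun i hi => by
      have := polynomial_eval_mono r hi
      exact ⟨(hN i).1.mono (by omega), (hN i).2.trans (by omega)⟩
  rw [foldr_encStrategy] at this
  refine this.mono (le_of_eq ?_)
  simp

end LogicalInduction

/-! ### Part: conjunctions, the enlarged deductive process and the conclusion. -/

namespace LogicalInduction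

variable {Atom : Type} {code : Atom → List Bool}

theorem ComputableIn.congr {α : Type} {s : α → ℕ} {ea f f' : α → List Sym}
    (h : ComputableIn s ea f) (e : ∀ a, f a = f' a) : ComputableIn s ea f' :=
  funext e ▸ h

/-! ### Conjunctions of initial segments -/

/-- Bracketing to the left moves all connectives to the front in prefix notation, so the
conjunctions are obtained by concatenation. -/
theorem encSentence_conjUpTo (ψ : ℕ → Sentence Atom) (n : ℕ) :
    encSentence code (conjUpTo ψ n) = (List.range n).flatMap (fun _ => [Sym.and]) ++
      ((List.range n).flatMap (fun i => encSentence code (ψ i)) ++ encSentence code (ψ n)) := by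
  induction n with
  | zero => simp [conjUpTo]
  | succ n ih =>
    have h : (List.range (n + 1)).flatMap (fun _ => [Sym.and]) =
        Sym.and :: (List.range n).flatMap (fun _ => [Sym.and]) := by
      rw [List.range_succ_eq_map, List.flatMap_cons, List.flatMap_map]
      rfl
    rw [conjUpTo, encSentence, ih, h, List.range_succ]
    simp

theorem effComputable_conjUpTo {ψ : ℕ → Sentence Atom}
    (hψ : EffComputable (encSentence code) ψ) :
    EffComputable (encSentence code) (conjUpTo ψ) := by
  rw [← computableIn_iff_effComputable] at hψ ⊢
  simp only [encSentence_conjUpTo]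
  have h : ∀ n : ℕ, n ≤ n := fun n => le_rfl
  exact .append h (.flatMap_range h monotone_id (computableIn_const _ h _))
    (.append h (.flatMap_range h monotone_id hψ) hψ)

theorem effComputable_const (ψ : Sentence Atom) :
    EffComputable (encSentence code) (fun _ => ψ) := by
  rw [← computableIn_iff_effComputable]
  exact computableIn_const _ (fun n => le_rfl) _

theorem World.PropConsistent.conjUpTo_eq_true {W : World Atom} (hW : W.PropConsistent)
    (ψ : ℕ → Sentence Atom) (n : ℕ) : W (conjUpTo ψ n) = true ↔ ∀ i ≤ n, W (ψ i) = true := by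
  induction n with
  | zero => simp [conjUpTo]
  | succ n ih => simp [conjUpTo, hW.and, ih, Nat.le_add_one_iff, or_imp, forall_and]

theorem pcWorlds_union_range_conjUpTo (Γ : Set (Sentence Atom)) (ψ : ℕ → Sentence Atom) :
    pcWorlds (Γ ∪ Set.range (conjUpTo ψ)) = pcWorlds (Γ ∪ Set.range ψ) := by
  ext W
  refine and_congr_right fun hW => ?_
  simp only [Set.mem_union, Set.mem_range, or_imp, forall_and, forall_exists_index,
    forall_apply_eq_imp_iff, hW.conjUpTo_eq_true]
  exact and_congr_right fun _ => ⟨fun h i => h i i le_rfl, fun h _ i _ => h i⟩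

/-! ### The buyer is efficiently computable -/

theorem effComputable_buyer {χ : ℕ → Sentence Atom} (hχ : EffComputable (encSentence code) χ) :
    EffComputable (encStrategy code) (buyer χ) := by
  rw [← computableIn_iff_effComputable] at hχ ⊢
  have h : ∀ n : ℕ, n ≤ n := fun n => le_rfl
  have hu := computableIn_unary (fun n => n) h
  have hw := computableIn_const (fun n => n) h
  have hx : ComputableIn (fun n => n) encUnary (fun n => encFeatExpr code (sharesExpr χ n)) := by
    refine (ComputableIn.append h (hw ([Sym.max, .const] ++ encRat 0 ++ [.add, .const] ++ encRat 1 ++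
      [.mul, .const] ++ encRat (-1) ++ [.mul, .price])) (.append h hχ (.append h hu
        (.append h (hw [.sep, .var]) (.append h hu (hw [.sep])))))).congr fun n => ?_
    simp [sharesExpr, encFeatExpr]
  have hd : ComputableIn (fun n => n) encUnary (fun n => Sym.define ::
      encFeatExpr code (.mul (.var n) (.add (.const 1) (sharesExpr χ n)))) := by
    refine (ComputableIn.append h (hw [Sym.define, .mul, .var]) (.append h hu
      (.append h (hw ([Sym.sep, .add, .const] ++ encRat 1)) hx))).congr fun n => ?_
    simp [encFeatExpr]
  refine (ComputableIn.append h (hw ([Sym.define, .const] ++ encRat 1))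
    (.append h (.flatMap_range h monotone_id hd) (.append h (hw [Sym.trade])
      (.append h hχ hx)))).congr fun n => ?_
  simp [encStrategy, buyer, encFeatExpr, List.flatMap_map]

/-! ### Adding a sequence of sentences to a deductive process -/

open Classical in
/-- The deductive process `D`, to which the sentences `χ` are added one by one. -/
noncomputable def adjoin (D : ℕ → Finset (Sentence Atom)) (χ : ℕ → Sentence Atom) (n : ℕ) :
    Finset (Sentence Atom) :=
  D n ∪ (Finset.range (n + 1)).image χ

theorem mem_adjoin {D : ℕ → Finset (Sentence Atom)} {χ : ℕ → Sentence Atom} (n : ℕ)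
    (φ : Sentence Atom) : φ ∈ adjoin D χ n ↔ φ ∈ D n ∨ ∃ i ≤ n, χ i = φ := by
  simp [adjoin]

theorem isDeductiveProcess_adjoin {D : ℕ → Finset (Sentence Atom)} {χ : ℕ → Sentence Atom}
    (hD : IsDeductiveProcess code D) (hχ : EffComputable (encSentence code) χ) :
    IsDeductiveProcess code (adjoin D χ) := by
  obtain ⟨hm, l, hl, hDl⟩ := hD
  refine ⟨fun m n hmn φ hφ => ?_, fun n => l n ++ (List.range (n + 1)).map χ, ?_, fun n φ => ?_⟩
  · rw [mem_adjoin] at hφ ⊢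
    exact hφ.imp (fun h => hm hmn h) fun ⟨i, hi, e⟩ => ⟨i, hi.trans hmn, e⟩
  · obtain ⟨s, hs⟩ := hl.computableIn
    -- No time bound is required, so any size that dominates both the run time of `l` and `n` will
    -- do.
    let s' : ℕ → ℕ := fun n => n + s n
    have h' : ∀ n, n ≤ s' n := fun n => Nat.le_add_right _ _
    have h : ∀ n : ℕ, n ≤ n := fun n => le_rfl
    rw [← computableIn_iff_effComputable] at hχ
    have hχ' := ComputableIn.append h (computableIn_const _ h [Sym.sep]) hχ
    refine ((hs.mono fun n => Nat.le_add_left (s n) n).append h'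
      (((hχ'.flatMap_range h monotone_id).append h hχ').mono h')).congr (f' := fun n =>
        encSentenceList code (l n ++ (List.range (n + 1)).map χ)) (fun n => ?_) |>.tmComputable
    simp [encSentenceList, List.range_succ, List.flatMap_map]
  · rw [mem_adjoin, hDl]
    simp

theorem isCompleteFor_adjoin {D : ℕ → Finset (Sentence Atom)} {χ : ℕ → Sentence Atom}
    {Γ : Set (Sentence Atom)} (hD : IsCompleteFor D Γ) :
    IsCompleteFor (adjoin D χ) (Γ ∪ Set.range χ) := by
  have h : ∀ A B : Set (Sentence Atom), pcWorlds (A ∪ B) = pcWorlds A ∩ pcWorlds B := by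
    intro A B
    ext W
    simp only [pcWorlds, Set.mem_ofPred_eq, Set.mem_inter_iff, Set.mem_union, or_imp, forall_and]
    tauto
  have e : (⋃ n, (adjoin D χ n : Set (Sentence Atom))) =
      (⋃ n, (D n : Set (Sentence Atom))) ∪ Set.range χ := by
    ext φ
    simp only [Set.mem_iUnion, Finset.mem_coe, mem_adjoin, Set.mem_union, Set.mem_range, exists_or]
    exact or_congr_right ⟨fun ⟨_, i, _, e⟩ => ⟨i, e⟩, fun ⟨i, e⟩ => ⟨i, i, le_rfl, e⟩⟩
  rw [IsCompleteFor, e, h, h, hD]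

/-! ### Conditioning on a decreasing sequence -/

theorem length_trades_le (T : Strategy Atom) : T.trades.length ≤ (encStrategy code T).length := by
  have : ∀ l : List (Sentence Atom × FeatExpr Atom), l.length ≤ (l.flatMap fun t =>
      Sym.trade :: (encSentence code t.1 ++ encFeatExpr code t.2)).length := by
    intro l
    induction l with
    | nil => simp
    | cons t l ih =>
      rw [List.flatMap_cons, List.length_append, List.length_cons, List.length_cons]
      omega
  rw [encStrategy, List.length_append]
  exact (this _).trans (Nat.le_add_left _ _)

theorem IsLogicalInductorOver.cond {Γ : Set (Sentence Atom)} {P : ℕ → Valuation Atom}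
    {χ : ℕ → Sentence Atom} (hP : IsLogicalInductorOver code P Γ)
    (hχ : EffComputable (encSentence code) χ)
    (hdec : ∀ W : World Atom, W.PropConsistent → ∀ n, W (χ (n + 1)) = true → W (χ n) = true) :
    IsLogicalInductorOver code (fun n => (P n).cond (χ n)) (Γ ∪ Set.range χ) := by
  obtain ⟨D, hDΓ, hM, hD, hnT⟩ := hP
  have hQ := hM.cond hχ
  have hD' := isDeductiveProcess_adjoin hD hχ
  refine ⟨adjoin D χ, isCompleteFor_adjoin hDΓ, hQ, hD', ?_⟩
  rintro ⟨T, hT, hTeff, hTex⟩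
  have h₀ : ∀ i φ, 0 ≤ P i φ := fun i φ => (hM.1 i φ).1
  apply hnT
  -- Price 0 belongs to the first case, where `priceCond` is exact; the negation then provides
  -- positive prices, as `tendsto_sum_shares` requires.
  by_cases hc : ∃ c : ℕ, ∀ n, P n (χ n) = 0 ∨ 1 ≤ c * P n (χ n)
  · obtain ⟨c, hc⟩ := hc
    -- Each trade may lose `1 / K`. The length in the exponent makes up for the number of trades,
    -- and the summand `n` leaves a total loss of at most `(1 / 2) ^ n` on day `n`.
    refine ⟨_, fun n => (hT n).condition, effComputable_condition c hχ hTeff,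
      hTex.condition (K := fun n => 2 ^ (n + (encStrategy code (T n)).length)) hdec hD.1 mem_adjoin
        h₀ hc (fun n => by positivity) fun n => ?_⟩
    have h : ((T n).trades.length : ℝ) ≤ 2 ^ (encStrategy code (T n)).length := by
      exact_mod_cast (length_trades_le (T n)).trans Nat.lt_two_pow_self.le
    push_cast
    rw [pow_add, one_div, inv_pow, div_le_iff₀ (by positivity), inv_mul_cancel_left₀ (by positivity)]
    exact h
  · push Not at hc
    exact ⟨buyer χ, buyer_wellFormed χ, effComputable_buyer hχ, buyer_exploits mem_adjoin h₀ hc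
      (hTex.exists_mem_pcWorlds hQ.1 hD'.1)⟩

end LogicalInduction

theorem mainTheorem10 {Atom : Type} (code : Atom → List Bool) (hcode : Function.Injective code)
    (Γ : Set (LogicalInduction.Sentence Atom)) (P : ℕ → LogicalInduction.Valuation Atom)
    (hP : LogicalInduction.IsLogicalInductorOver code P Γ) :
    (∀ ψ : LogicalInduction.Sentence Atom,
      LogicalInduction.IsLogicalInductorOver code (fun n => (P n).cond ψ) (Γ ∪ {ψ})) ∧
    (∀ ψ : ℕ → LogicalInduction.Sentence Atom,
      LogicalInduction.EffComputable (LogicalInduction.encSentence code) ψ →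
        LogicalInduction.IsLogicalInductorOver code
          (fun n => (P n).cond (LogicalInduction.conjUpTo ψ n)) (Γ ∪ Set.range ψ)) := by
  refine ⟨fun ψ => ?_, fun ψ hψ => ?_⟩
  · have h := hP.cond (LogicalInduction.effComputable_const ψ) fun _ _ _ h => h
    rwa [Set.range_const] at h
  -- The process obtained is complete for the set of conjunctions, which has the same consistent
  -- worlds as the set of their conjuncts.
  · obtain ⟨D, hD, h⟩ := hP.cond (LogicalInduction.effComputable_conjUpTo hψ)
      fun W hW n h => (hW.conjUpTo_eq_true ψ n).2 fun i hi =>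
        (hW.conjUpTo_eq_true ψ (n + 1)).1 h i (hi.trans n.le_succ)
    exact ⟨D, hD.trans (LogicalInduction.pcWorlds_union_range_conjUpTo Γ ψ), h⟩
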